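/- **Theorem (Exchangeable Cluster/Partition Probability Functions).** Let $\Omega$ be a measurable space possessing a countable family of measurable sets that separates points (e.g. a Polish space with its Borel sets), let $G_0$ be a finite measure on $\Omega$ with $G_0(\{\omega\})=0$ for all $\omega\in\Omega$, put $\gamma_0=G_0(\Omega)$, and let $\rho$ be a measure with $\int_{(0,\infty)}\min\{1,r\}\,\rho(dr)<\infty$; all integrals $\int_0^\infty$ below are over $(0,\infty)$. Let $$G=\sum_{k<K} r_k\,\delta_{\omega_k},\qquad K\in\{0,1,2,\dots,\infty\},$$ with random weights $r_k>0$ and pairwise distinct random atoms $\omega_k\in\Omega$, be a completely random measure with $G(\Omega)<\infty$ a.s. and Lévy measure $\nu(dr\,d\omega)=\rho(dr)G_0(d\omega)$; that is, $G$ takes independent values on disjoint measurable sets and $\mathbb E[e^{iuG(A)}]=\exp\big(\iint_{(0,\infty)\times A}(e^{iur}-1)\,\nu(dr\,d\omega)\big)$ for measurable $A\subset\Omega$, $u\in\mathbb R$. In the *count-mixture model*, conditionally on $(K,(r_k),(\omega_k))$, the sample size is $m\sim\mathrm{Pois}(G(\Omega))$ and, given $m$, the labels $z_1,\dots,z_m$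 are i.i.d. with distribution $\sum_{k<K}\frac{r_k}{G(\Omega)}\delta_k$ (if $G(\Omega)=0$ then $m=0$). Relabel $\boldsymbol z=(z_1,\dots,z_m)$ in order of appearance by $1,\dots,l$, where $l$ is the number of distinct labels (clusters), and let $n_k$ be the number of $i\le m$ with relabelled $z_i=k$. Then: 1. *(ECPF)* For every $m\ge 0$ and every sequence $\boldsymbol z\in\{1,2,\dots\}^m$ labelled in order of appearance, the probability $f(\boldsymbol z,m\mid\gamma_0,\rho)$ that the sample has size $m$ and relabelled labels $\boldsymbol z$ is $$f(\boldsymbol z,m\mid\gamma_0,\rho)=\mathbb E_G[f(\boldsymbol z,m\mid G)]=\frac{\gamma_0^{\,l}}{m!}\,\exp\Big(\gamma_0\int_0^\infty(e^{-r}-1)\,\rho(dr)\Big)\prod_{k=1}^{l}\int_0^\infty r^{n_k}e^{-r}\,\rho(dr),$$ where $f(\boldsymbol z,m\mid G)$ is the conditional probability of the same event given $(K,(r_k),(\omega_k))$. In particular it is exchangeable: it depends on $\boldsymbol z$ only through the number and the (unordered) sizes of the clusters. All the integrals (here and in 2) converge. 2. *(Sample size)* For real $t$ with $|t|\le 1$,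 the PGF of $m$ is $$\mathbb E[t^m]=\exp\Big(\gamma_0\int_0^\infty\big(e^{-(1-t)r}-1\big)\,\rho(dr)\Big).$$ It is analytic at $t=0$, and the PMF of $m$ is $f_M(m\mid\gamma_0,\rho)=\frac1{m!}\,\frac{d^m}{dt^m}\,\mathbb E[t^{m}]\Big|_{t=0}$ (here the expectation is the PGF as a function of $t$, differentiated $m$ times). 3. *(EPPF)* Whenever $f_M(m\mid\gamma_0,\rho)>0$, the conditional probability of the relabelled sequence $\boldsymbol z$ given that the sample has size $m$ is $$f(\boldsymbol z\mid m,\gamma_0,\rho)=\frac{f(\boldsymbol z,m\mid\gamma_0,\rho)}{f_M(m\mid\gamma_0,\rho)},$$ with $f(\boldsymbol z,m\mid\gamma_0,\rho)$ given by the product formula in 1, and it is exchangeable in the same sense. -/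

import Mathlib

open MeasureTheory ProbabilityTheory Set

noncomputable section

namespace CountMixture

/-- The discrete measure `∑_{k < K} r_k δ_{ω_k}`, where `K ≤ ∞`. -/
def atomicMeasure {Ω : Type*} [MeasurableSpace Ω] (K : ℕ∞) (r : ℕ → ℝ) (ω : ℕ → Ω) :
    Measure Ω :=
  Measure.sum fun k : {k : ℕ // (k : ℕ∞) < K} => ENNReal.ofReal (r k) • Measure.dirac (ω k)

/-- The homogeneous Lévy measure `ν(dr dω) = ρ(dr) G₀(dω)` on `(0, ∞) × Ω`. -/
def levyMeasure {Ω : Type*} [MeasurableSpace Ω] (ρ : Measure ℝ) (G₀ : Measure Ω) :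
    Measure (ℝ × Ω) :=
  (ρ.restrict (Ioi 0)).prod G₀

/-- `G` is a completely random measure with (almost surely) finite total mass and Lévy
measure `ν`: the masses of disjoint measurable sets are independent, and
`E[exp(iuG(A))] = exp(∫∫_{ℝ₊ × A} (e^{iur} - 1) ν(dr dω))`. -/
structure IsCompletelyRandomMeasure {S Ω : Type*} [MeasurableSpace S] [MeasurableSpace Ω]
    (P : Measure S) (G : S → Measure Ω) (ν : Measure (ℝ × Ω)) : Prop where
  measurable : Measurable G
  finite : ∀ᵐ s ∂P, G s univ < ⊤
  indep : ∀ (n : ℕ) (A : Fin n → Set Ω), (∀ i, MeasurableSet (A i)) →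
    (∀ i j, i ≠ j → Disjoint (A i) (A j)) → iIndepFun (fun i s => G s (A i)) P
  charFun : ∀ A : Set Ω, MeasurableSet A → ∀ u : ℝ,
    ∫ s, Complex.exp (Complex.I * u * ((G s A).toReal : ℂ)) ∂P =
      Complex.exp (∫ x in univ ×ˢ A, (Complex.exp (Complex.I * u * (x.1 : ℂ)) - 1) ∂ν)

/-- The conditional likelihood of `(z, m)` given `G = ∑_{k < K} r_k δ_{ω_k}`:
`m ∼ Pois(G(Ω))` and, given `m`, the labels `z_1, …, z_m` are independent draws from
`∑_{k < K} (r_k / G(Ω)) δ_k`. -/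
def likelihood {Ω : Type*} [MeasurableSpace Ω] (K : ℕ∞) (r : ℕ → ℝ) (ω : ℕ → Ω)
    (m : ℕ) (c : Fin m → ℕ) : ℝ :=
  (poissonMeasure (atomicMeasure K r ω univ).toNNReal).real {m} *
    ∏ i, if (c i : ℕ∞) < K then r (c i) / (atomicMeasure K r ω univ).toReal else 0

/-- The σ-algebra generated by the atoms `(K, r, ω)` of `G`. -/
abbrev atomsSigma {S Ω : Type*} [MeasurableSpace Ω]
    (K : S → ℕ∞) (r : ℕ → S → ℝ) (ω : ℕ → S → Ω) : MeasurableSpace S :=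
  MeasurableSpace.comap (fun s => (K s, (fun k => r k s), (fun k => ω k s))) inferInstance

/-- The count-mixture model. The random measure `G = ∑_{k < K} r_k δ_{ω_k}`, with weights
`r_k > 0` at pairwise distinct atoms `ω_k`, is a completely random measure with Lévy measure
`ρ(dr) G₀(dω)`; given the atoms of `G`, the sample size `M` is Poisson with mean `G(Ω)`, and the
labels `z_0, …, z_{M-1}` are iid with `P(z_i = k) = r_k / G(Ω)` (the later `z_i` play no role). -/
structure IsCountMixture {S Ω : Type*} [MeasurableSpace S] [MeasurableSpace Ω]
    (P : Measure S) (G₀ : Measure Ω) (ρ : Measure ℝ)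
    (K : S → ℕ∞) (r : ℕ → S → ℝ) (ω : ℕ → S → Ω) (M : S → ℕ) (z : ℕ → S → ℕ) : Prop where
  measurable_K : Measurable K
  measurable_r : ∀ k, Measurable (r k)
  measurable_ω : ∀ k, Measurable (ω k)
  measurable_M : Measurable M
  measurable_z : ∀ i, Measurable (z i)
  pos : ∀ᵐ s ∂P, ∀ k : ℕ, (k : ℕ∞) < K s → 0 < r k s
  distinct : ∀ᵐ s ∂P, ∀ j k : ℕ, (j : ℕ∞) < K s → (k : ℕ∞) < K s → ω j s = ω k s → j = k
  crm : IsCompletelyRandomMeasure P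
    (fun s => atomicMeasure (K s) (fun k => r k s) (fun k => ω k s)) (levyMeasure ρ G₀)
  sample : ∀ (m : ℕ) (c : Fin m → ℕ),
    P⟦{s | M s = m ∧ (fun i : Fin m => z i s) = c} | atomsSigma K r ω⟧ =ᵐ[P]
      fun s => likelihood (K s) (fun k => r k s) (fun k => ω k s) m c

/-- Relabelling of a finite sequence in order of appearance, by `1, 2, …, l`: the new label of
`z_i` is the number of distinct values among `z_0, …, z_j`, where `j` is the first index with
`z_j = z_i`. -/
def relabel {m : ℕ} (z : Fin m → ℕ) (i : Fin m) : ℕ :=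
  ((Finset.univ.filter fun j : Fin m => ∀ k, z k = z i → j ≤ k).image z).card

/-- The number `l` of clusters. -/
def numClusters {m : ℕ} (c : Fin m → ℕ) : ℕ := (Finset.univ.image c).card

/-- The size `n_k` of cluster `k`. -/
def clusterSize {m : ℕ} (c : Fin m → ℕ) (k : ℕ) : ℕ :=
  (Finset.univ.filter fun i => c i = k).card

/-- The unordered cluster sizes `n_1, …, n_l` (with multiplicity). -/
def clusterSizes {m : ℕ} (c : Fin m → ℕ) : Multiset ℕ :=
  (Finset.Icc 1 (numClusters c)).val.map (clusterSize c)

/-- The event that the sample has size `m` and its labels, in order of appearance, are `c`. -/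
def clusterEvent {S : Type*} (M : S → ℕ) (z : ℕ → S → ℕ) (m : ℕ) (c : Fin m → ℕ) : Set S :=
  {s | M s = m ∧ relabel (fun i : Fin m => z i s) = c}

/-- The cluster probability function `f(z, m)`: joint distribution of the sample size and of the
labels in order of appearance. -/
def ecpf {S : Type*} [MeasurableSpace S] (P : Measure S) (M : S → ℕ) (z : ℕ → S → ℕ)
    (m : ℕ) (c : Fin m → ℕ) : ℝ :=
  P.real (clusterEvent M z m c)

/-- The probability mass function `f_M(m)` of the sample size. -/
def sizePMF {S : Type*} [MeasurableSpace S] (P : Measure S) (M : S → ℕ) (m : ℕ) : ℝ :=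
  P.real {s | M s = m}

/-- The probability generating function `t ↦ E[t^M]` of the sample size. -/
def sizePGF {S : Type*} [MeasurableSpace S] (P : Measure S) (M : S → ℕ) (t : ℝ) : ℝ :=
  ∫ s, t ^ M s ∂P

/-- The partition probability function `f(z | m)`: conditional distribution, given that the
sample has size `m`, of the labels in order of appearance. -/
def eppf {S : Type*} [MeasurableSpace S] (P : Measure S) (M : S → ℕ) (z : ℕ → S → ℕ)
    (m : ℕ) (c : Fin m → ℕ) : ℝ :=
  (P[|{s | M s = m}]).real {s | relabel (fun i : Fin m => z i s) = c}

/-- A function of label sequences in order of appearance is exchangeable if it depends only on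
the number and the sizes of the clusters, regardless of their order. -/
def IsExchangeable (f : ∀ m : ℕ, (Fin m → ℕ) → ℝ) : Prop :=
  ∀ (m : ℕ) (c c' : Fin m → ℕ), relabel c = c → relabel c' = c' →
    clusterSizes c = clusterSizes c' → f m c = f m c'

/-- The product formula
`γ₀^l / m! · exp(γ₀ ∫ (e^{-r} - 1) ρ(dr)) · ∏_{k=1}^l ∫ r^{n_k} e^{-r} ρ(dr)`. -/
def ecpfFormula (γ₀ : ℝ) (ρ : Measure ℝ) (m : ℕ) (c : Fin m → ℕ) : ℝ :=
  γ₀ ^ numClusters c / (m.factorial : ℝ) *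
    Real.exp (γ₀ * ∫ r in Ioi (0 : ℝ), (Real.exp (-r) - 1) ∂ρ) *
    ∏ k ∈ Finset.Icc 1 (numClusters c),
      ∫ r in Ioi (0 : ℝ), r ^ clusterSize c k * Real.exp (-r) ∂ρ

end CountMixture

end

noncomputable section

namespace CountMixture

open Filter Topology

/-! Write g = G(Ω). The Poisson mass e^{-g} g^m / m! cancels the normalisations r_k / g, so a label
sequence k has conditional probability e^{-g}/m! · ∏ r_{k_i}. A pattern in order of appearance is
the same thing as the kernel of the label sequence (`relabel_eq_iff`). Its probability is therefore
the mean of e^{-g}/m! times the sum of ∏ r_{k_i} over the sequences k with that kernel.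

This sum over distinct atoms is reached without Palm calculus. An injection of Ω into binary
sequences cuts Ω into at most 2^N cells. The sum over assignments of distinct cells to the l
clusters, of the products of G-masses of cells, converges to the sum over distinct atoms
(`tendsto_tsum_indicator_cells`), with dominating constant 1 after multiplication by e^{-g}/m!.

For fixed N, independence over disjoint cells factors the mean into E[e^{-g}] and tilted moments
E[G(A)^n e^{-G(A)}] / E[e^{-G(A)}] (`integral_exp_neg_mul_prod`). The characteristic function is
continued to the Laplace transform by Phragmén–Lindelöf, and differentiating the latter gives a
recursion for these moments. By the recursion each equals G₀(A) κ_n + O(G₀(A)²), where κ_n = ∫ r^n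
e^{-r} dρ (`exists_bound_momentSeq_sub`). Since G₀ has no atoms, the squares of the cell masses sum
to o(1). Quadratic errors and coinciding cells thus disappear, leaving γ₀^l ∏ κ_{n_k}
(`tendsto_sum_injective`).

The size is mixed Poisson, so its PGF at t is the Laplace transform of g at 1 - t. The EPPF is a
quotient of the two probabilities. -/

/-! ### Elementary bounds by multiples of min(1, x). -/

/-- Mean value inequality on the convex left half-plane, where the derivative of exp has norm at
most 1. -/
theorem norm_cexp_sub_one_le {w : ℂ} (hw : w.re ≤ 0) : ‖Complex.exp w - 1‖ ≤ ‖w‖ := by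
  have h := (convex_halfSpace_re_le 0).norm_image_sub_le_of_norm_deriv_le (f := Complex.exp)
    (C := 1) (x := 0) (y := w) (fun z _ => Complex.differentiable_exp z)
    (fun z hz => by simpa [Complex.norm_exp] using hz) (by simp) hw
  simpa using h

theorem norm_cexp_mul_sub_one_le {w : ℂ} (hw : w.re ≤ 0) {x : ℝ} (hx : 0 ≤ x) :
    ‖Complex.exp (w * x) - 1‖ ≤ (2 + ‖w‖) * min 1 x := by
  have hre : (w * x).re ≤ 0 := by simpa using mul_nonpos_of_nonpos_of_nonneg hw hx
  rcases le_total 1 x with h | h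
  · rw [min_eq_left h]
    have h1 : ‖Complex.exp (w * x)‖ ≤ 1 := by rw [Complex.norm_exp]; simpa using hre
    have h2 := norm_sub_le (Complex.exp (w * x)) 1
    rw [norm_one] at h2
    nlinarith [norm_nonneg w]
  · rw [min_eq_right h]
    have h1 := norm_cexp_sub_one_le hre
    rw [norm_mul, Complex.norm_real, Real.norm_of_nonneg hx] at h1
    nlinarith [norm_nonneg w]

theorem mul_exp_neg_mul_le {ε : ℝ} (hε : 0 < ε) {x : ℝ} (hx : 0 ≤ x) :
    x * Real.exp (-ε * x) ≤ (1 + 1 / ε) * min 1 x := by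
  have h1 : Real.exp (-ε * x) ≤ 1 := Real.exp_le_one_iff.2 (by nlinarith)
  have h0 : 0 < 1 / ε := by positivity
  rcases le_total 1 x with h | h
  · rw [min_eq_left h]
    have h2 : ε * x * Real.exp (-ε * x) ≤ 1 := by
      have h3 : ε * x ≤ Real.exp (ε * x) := by linarith [Real.add_one_le_exp (ε * x)]
      calc ε * x * Real.exp (-ε * x) ≤ Real.exp (ε * x) * Real.exp (-ε * x) := by gcongr
        _ = 1 := by rw [← Real.exp_add]; simp
    have h4 : x * Real.exp (-ε * x) = (ε * x * Real.exp (-ε * x)) / ε := by field_simp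
    have h5 : (ε * x * Real.exp (-ε * x)) / ε ≤ 1 / ε := by gcongr
    linarith
  · rw [min_eq_right h]
    nlinarith

theorem pow_mul_exp_neg_le (n : ℕ) {x : ℝ} (hx : 0 ≤ x) :
    x ^ n * Real.exp (-x) ≤ n.factorial := by
  have h := Real.pow_div_factorial_le_exp x hx n
  rw [div_le_iff₀ (by positivity)] at h
  calc x ^ n * Real.exp (-x) ≤ (Real.exp x * n.factorial) * Real.exp (-x) := by gcongr
    _ = n.factorial * (Real.exp x * Real.exp (-x)) := by ring
    _ = n.factorial := by rw [← Real.exp_add]; simp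

theorem pow_mul_exp_neg_le_min {n : ℕ} (hn : 1 ≤ n) {x : ℝ} (hx : 0 ≤ x) :
    x ^ n * Real.exp (-x) ≤ n.factorial * min 1 x := by
  rcases le_total 1 x with h | h
  · simpa [min_eq_left h] using pow_mul_exp_neg_le n hx
  · rw [min_eq_right h]
    have h1 : x ^ n ≤ x := pow_le_of_le_one hx h (by omega)
    have h2 : Real.exp (-x) ≤ 1 := Real.exp_le_one_iff.2 (by linarith)
    have h3 : (1 : ℝ) ≤ n.factorial := by exact_mod_cast n.factorial_pos
    calc x ^ n * Real.exp (-x) ≤ x * 1 := by gcongr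
      _ ≤ n.factorial * x := by nlinarith

/-! ### Laplace exponents, analytic continuation and tilted moments. -/

/-- The Laplace exponent `w ↦ ∫ (exp (w X) - 1) dμ`. -/
def laplaceExponent {α : Type*} [MeasurableSpace α] (X : α → ℝ) (μ : Measure α) (w : ℂ) : ℂ :=
  ∫ a, (Complex.exp (w * X a) - 1) ∂μ

section Laplace

variable {α : Type*} [MeasurableSpace α] {μ : Measure α} {X : α → ℝ}

theorem integrable_cexp_sub_one (hX : Measurable X) (hpos : ∀ᵐ a ∂μ, 0 ≤ X a)
    (hint : Integrable (fun a => min 1 (X a)) μ) {w : ℂ} (hw : w.re ≤ 0) :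
    Integrable (fun a => Complex.exp (w * X a) - 1) μ := by
  refine Integrable.mono' (hint.const_mul (2 + ‖w‖)) (by fun_prop) ?_
  filter_upwards [hpos] with a ha using norm_cexp_mul_sub_one_le hw ha

theorem hasDerivAt_laplaceExponent (hX : Measurable X) (hpos : ∀ᵐ a ∂μ, 0 ≤ X a)
    (hint : Integrable (fun a => min 1 (X a)) μ) {w : ℂ} (hw : w.re < 0) :
    HasDerivAt (laplaceExponent X μ) (∫ a, X a * Complex.exp (w * X a) ∂μ) w := by
  -- For Re z < Re w / 2, the derivative X e^{zX} is dominated by X e^{-εX} with ε = -Re w / 2.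
  have hε : 0 < -w.re / 2 := by linarith
  have hs : {z : ℂ | z.re < w.re / 2} ∈ 𝓝 w :=
    (isOpen_Iio.preimage Complex.continuous_re).mem_nhds (by simp; linarith)
  refine (hasDerivAt_integral_of_dominated_loc_of_deriv_le (μ := μ)
    (F := fun w a => Complex.exp (w * X a) - 1) (F' := fun w a => X a * Complex.exp (w * X a))
    (bound := fun a => (1 + 1 / (-w.re / 2)) * min 1 (X a)) hs ?_
    (integrable_cexp_sub_one hX hpos hint hw.le) (by fun_prop) ?_ (hint.const_mul _) ?_).2
  · exact Eventually.of_forall fun z => by fun_prop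
  · filter_upwards [hpos] with a ha z hz
    refine le_trans ?_ (mul_exp_neg_mul_le hε ha)
    rw [norm_mul, Complex.norm_exp, Complex.norm_real, Real.norm_of_nonneg ha]
    simp only [Complex.re_mul_ofReal]
    have : z.re ≤ -(-w.re / 2) := by have := Set.mem_ofPred.1 hz; linarith
    gcongr
  · refine Eventually.of_forall fun a z _ => ?_
    have h := (((hasDerivAt_id z).mul_const (X a : ℂ)).cexp).sub_const 1
    simpa [mul_comm] using h

theorem continuousOn_laplaceExponent (hX : Measurable X) (hpos : ∀ᵐ a ∂μ, 0 ≤ X a)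
    (hint : Integrable (fun a => min 1 (X a)) μ) :
    ContinuousOn (laplaceExponent X μ) {w | w.re ≤ 0} := by
  intro w _
  refine tendsto_integral_filter_of_dominated_convergence
    (fun a => (2 + (‖w‖ + 1)) * min 1 (X a)) (Eventually.of_forall fun z => by fun_prop) ?_
    (hint.const_mul _) ?_
  · have h1 : ∀ᶠ z in 𝓝[{w : ℂ | w.re ≤ 0}] w, ‖z‖ < ‖w‖ + 1 :=
      (continuous_norm.tendsto w).mono_left nhdsWithin_le_nhds |>.eventually_lt_const (by linarith)
    filter_upwards [h1, self_mem_nhdsWithin] with z hz hz'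
    filter_upwards [hpos] with a ha
    refine (norm_cexp_mul_sub_one_le hz' ha).trans ?_
    have : 0 ≤ min 1 (X a) := le_min zero_le_one ha
    gcongr
  · refine Eventually.of_forall fun a => Tendsto.mono_left ?_ nhdsWithin_le_nhds
    exact Continuous.tendsto (by fun_prop) w

theorem re_laplaceExponent_nonpos (hX : Measurable X) (hpos : ∀ᵐ a ∂μ, 0 ≤ X a)
    (hint : Integrable (fun a => min 1 (X a)) μ) {w : ℂ} (hw : w.re ≤ 0) :
    (laplaceExponent X μ w).re ≤ 0 := by
  have h : (laplaceExponent X μ w).re = ∫ a, (Complex.exp (w * X a) - 1).re ∂μ :=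
    (integral_re (𝕜 := ℂ) (integrable_cexp_sub_one hX hpos hint hw)).symm
  rw [h]
  refine integral_nonpos_of_ae ?_
  filter_upwards [hpos] with a ha
  have h1 : (Complex.exp (w * X a)).re ≤ 1 := by
    refine (Complex.re_le_norm _).trans ?_
    rw [Complex.norm_exp]
    simpa using mul_nonpos_of_nonpos_of_nonneg hw ha
  simpa using h1

/-- The reflection w ↦ -w moves the domain to the right half-plane, where Phragmén–Lindelöf is
applied. -/
theorem diffContOnCl_laplaceExponent_neg (hX : Measurable X) (hpos : ∀ᵐ a ∂μ, 0 ≤ X a)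
    (hint : Integrable (fun a => min 1 (X a)) μ) :
    DiffContOnCl ℂ (fun w => laplaceExponent X μ (-w)) {w | 0 < w.re} := by
  constructor
  · intro w hw
    have h : HasDerivAt (laplaceExponent X μ) _ (-w) :=
      hasDerivAt_laplaceExponent hX hpos hint (by simpa using hw)
    exact (h.comp w (hasDerivAt_neg w)).differentiableAt.differentiableWithinAt
  · rw [Complex.closure_setOfPred_lt_re]
    exact (continuousOn_laplaceExponent hX hpos hint).comp continuous_neg.continuousOn
      (fun w hw => by simpa using hw)

/-- A characteristic function of Lévy–Khinchin type determines the Laplace transform of a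
nonnegative random variable. -/
theorem one_add_laplaceExponent_eq {β : Type*} [MeasurableSpace β] {P : Measure β}
    [IsProbabilityMeasure P] {Y : β → ℝ} (hY : Measurable Y) (hYpos : ∀ b, 0 ≤ Y b)
    (hX : Measurable X) (hpos : ∀ᵐ a ∂μ, 0 ≤ X a)
    (hint : Integrable (fun a => min 1 (X a)) μ) {x : ℝ} (hx : 0 ≤ x)
    (h : ∀ u : ℝ, 1 + laplaceExponent Y P (u * Complex.I) =
      Complex.exp (x * laplaceExponent X μ (u * Complex.I))) {w : ℂ} (hw : w.re ≤ 0) :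
    1 + laplaceExponent Y P w = Complex.exp (x * laplaceExponent X μ w) := by
  -- No moment of Y is needed: writing E[e^{wY}] as 1 plus a Laplace exponent puts Y and the Lévy
  -- measure under the same lemmas.
  have hYint : Integrable (fun b => min 1 (Y b)) P := by
    refine Integrable.mono' (integrable_const 1) (by fun_prop) (Eventually.of_forall fun b => ?_)
    rw [Real.norm_of_nonneg (le_min zero_le_one (hYpos b))]
    exact min_le_left _ _
  have hYpos' : ∀ᵐ b ∂P, 0 ≤ Y b := Eventually.of_forall hYpos
  let f : ℂ → ℂ := fun w =>
    1 + laplaceExponent Y P (-w) - Complex.exp (x * laplaceExponent X μ (-w))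
  have hbound : ∀ z : ℂ, 0 ≤ z.re → ‖f z‖ ≤ 2 := by
    intro z hz
    have hz' : (-z).re ≤ 0 := by simpa using hz
    have h1 : ‖1 + laplaceExponent Y P (-z)‖ ≤ 1 := by
      have : 1 + laplaceExponent Y P (-z) = ∫ b, Complex.exp (-z * Y b) ∂P := by
        have h2 := integral_add (integrable_const (1 : ℂ))
          (integrable_cexp_sub_one hY hYpos' hYint hz')
        simpa [laplaceExponent] using h2.symm
      rw [this]
      refine (norm_integral_le_of_norm_le_const (C := 1) (Eventually.of_forall fun b => ?_)).trans
        (by simp)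
      rw [Complex.norm_exp, Complex.re_mul_ofReal]
      exact Real.exp_le_one_iff.2 (mul_nonpos_of_nonpos_of_nonneg hz' (hYpos b))
    have h2 : ‖Complex.exp (x * laplaceExponent X μ (-z))‖ ≤ 1 := by
      rw [Complex.norm_exp, Complex.re_ofReal_mul]
      exact Real.exp_le_one_iff.2 (mul_nonpos_of_nonneg_of_nonpos hx
        (re_laplaceExponent_nonpos hX hpos hint hz'))
    calc ‖f z‖ ≤ _ := norm_sub_le _ _
      _ ≤ 2 := by linarith
  have hd : DiffContOnCl ℂ f {w | 0 < w.re} := by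
    refine DiffContOnCl.sub ?_ ?_
    · exact (diffContOnCl_laplaceExponent_neg hY hYpos' hYint).const_add 1
    · exact Complex.differentiable_exp.comp_diffContOnCl
        ((diffContOnCl_laplaceExponent_neg hX hpos hint).const_smul (x : ℂ))
  -- f is bounded by 2 on the closed half-plane and vanishes on the imaginary axis. The bound 0 on
  -- the axis propagates inside.
  have key : ‖f (-w)‖ ≤ 0 := by
    refine PhragmenLindelof.right_half_plane_of_bounded_on_real hd ⟨1, by norm_num, 0, ?_⟩ ?_ ?_
      (by simpa using hw)
    · refine Asymptotics.IsBigO.of_bound 2 ?_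
      filter_upwards [mem_inf_of_right (mem_principal_self _)] with z hz
      simpa using hbound z (le_of_lt hz)
    · refine ⟨2, ?_⟩
      rw [eventually_map]
      filter_upwards [eventually_ge_atTop 0] with t ht using hbound t (by simpa using ht)
    · intro t
      have h3 := h (-t)
      simp only [Complex.ofReal_neg, neg_mul] at h3
      simp [f, h3]
  have := norm_le_zero_iff.1 key
  simpa [f, sub_eq_zero] using this

/-- The real Laplace exponent. -/
theorem laplaceExponent_ofReal (t : ℝ) :
    laplaceExponent X μ t = ((∫ a, (Real.exp (t * X a) - 1) ∂μ : ℝ) : ℂ) := by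
  rw [laplaceExponent, ← integral_complex_ofReal]
  congr with a
  push_cast
  rfl

theorem integrable_exp_mul_sub_one (hX : Measurable X) (hpos : ∀ᵐ a ∂μ, 0 ≤ X a)
    (hint : Integrable (fun a => min 1 (X a)) μ) {t : ℝ} (ht : t ≤ 0) :
    Integrable (fun a => Real.exp (t * X a) - 1) μ := by
  have := (integrable_cexp_sub_one hX hpos hint (w := t) (by simpa using ht)).re
  refine this.congr (Eventually.of_forall fun a => ?_)
  simp [← Complex.ofReal_mul, Complex.exp_ofReal_re]

theorem integrable_pow_mul_exp_neg (hX : Measurable X) (hpos : ∀ᵐ a ∂μ, 0 ≤ X a)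
    (hint : Integrable (fun a => min 1 (X a)) μ) {n : ℕ} (hn : 1 ≤ n) :
    Integrable (fun a => X a ^ n * Real.exp (-X a)) μ := by
  refine Integrable.mono' (hint.const_mul (n.factorial : ℝ)) (by fun_prop) ?_
  filter_upwards [hpos] with a ha
  rw [Real.norm_of_nonneg (by positivity)]
  exact pow_mul_exp_neg_le_min hn ha

/-- The measure `X dμ`. -/
def weighted (X : α → ℝ) (μ : Measure α) : Measure α := μ.withDensity fun a => ENNReal.ofReal (X a)

theorem integral_weighted (hX : Measurable X) (hpos : ∀ᵐ a ∂μ, 0 ≤ X a) (f : α → ℝ) :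
    ∫ a, f a ∂(weighted X μ) = ∫ a, X a * f a ∂μ := by
  rw [weighted, integral_withDensity_eq_integral_toReal_smul hX.ennreal_ofReal (by simp)]
  refine integral_congr_ae ?_
  filter_upwards [hpos] with a ha
  simp [ENNReal.toReal_ofReal ha]

/-- The measure μ may be infinite near X = 0, where e^{tX} alone need not be integrable. The weight
X repairs this, so the derivatives of the Laplace exponent become derivatives of an honest `mgf`. -/
theorem Iio_subset_interior_integrableExpSet (hX : Measurable X) (hpos : ∀ᵐ a ∂μ, 0 ≤ X a)
    (hint : Integrable (fun a => min 1 (X a)) μ) :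
    Iio 0 ⊆ interior (integrableExpSet X (weighted X μ)) := by
  refine interior_maximal (fun t ht => ?_) isOpen_Iio
  have ht' : 0 < -t := by simpa using ht
  rw [integrableExpSet, mem_ofPred, weighted,
    integrable_withDensity_iff_integrable_smul' hX.ennreal_ofReal (by simp)]
  refine Integrable.mono' (hint.const_mul (1 + 1 / -t)) (by fun_prop) ?_
  filter_upwards [hpos] with a ha
  simp only [ENNReal.toReal_ofReal ha, smul_eq_mul]
  rw [Real.norm_of_nonneg (by positivity)]
  simpa using mul_exp_neg_mul_le ht' ha

theorem hasDerivAt_integral_exp_sub_one (hX : Measurable X) (hpos : ∀ᵐ a ∂μ, 0 ≤ X a)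
    (hint : Integrable (fun a => min 1 (X a)) μ) {t : ℝ} (ht : t < 0) :
    HasDerivAt (fun t => ∫ a, (Real.exp (t * X a) - 1) ∂μ) (mgf X (weighted X μ) t) t := by
  have h := (hasDerivAt_laplaceExponent hX hpos hint (w := t) (by simpa using ht)).real_of_complex
  simp only [laplaceExponent_ofReal, Complex.ofReal_re] at h
  convert! h using 1
  rw [mgf, integral_weighted hX hpos]
  have : (∫ a, X a * Complex.exp (t * X a) ∂μ) =
      ((∫ a, X a * Real.exp (t * X a) ∂μ : ℝ) : ℂ) := by
    rw [← integral_complex_ofReal]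
    congr with a
    push_cast
    rfl
  rw [this, Complex.ofReal_re]

theorem iteratedDeriv_mgf_weighted (hX : Measurable X) (hpos : ∀ᵐ a ∂μ, 0 ≤ X a)
    (hint : Integrable (fun a => min 1 (X a)) μ) (n : ℕ) :
    iteratedDeriv n (mgf X (weighted X μ)) (-1) = ∫ a, X a ^ (n + 1) * Real.exp (-X a) ∂μ := by
  rw [iteratedDeriv_mgf (Iio_subset_interior_integrableExpSet hX hpos hint (by simp)),
    integral_weighted hX hpos]
  congr with a
  simp
  ring

/-- Recursion for the exponentially tilted moments of a random variable whose log-Laplace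
transform is `x` times the Laplace exponent of `μ`. -/
theorem moment_succ_eq {β : Type*} [MeasurableSpace β] {P : Measure β}
    [IsProbabilityMeasure P] {Y : β → ℝ} (hY : Measurable Y) (hYpos : ∀ b, 0 ≤ Y b)
    (hX : Measurable X) (hpos : ∀ᵐ a ∂μ, 0 ≤ X a)
    (hint : Integrable (fun a => min 1 (X a)) μ) {x : ℝ}
    (h : ∀ t ≤ 0, mgf Y P t = Real.exp (x * ∫ a, (Real.exp (t * X a) - 1) ∂μ)) (n : ℕ) :
    ∫ b, Y b ^ (n + 1) * Real.exp (-Y b) ∂P =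
      x * ∑ i ∈ Finset.range (n + 1), n.choose i * (∫ a, X a ^ (i + 1) * Real.exp (-X a) ∂μ) *
        ∫ b, Y b ^ (n - i) * Real.exp (-Y b) ∂P := by
  have hYexp : (-1 : ℝ) ∈ interior (integrableExpSet Y P) := by
    refine interior_maximal (fun t ht => ?_) isOpen_Iio (show (-1 : ℝ) ∈ Iio 0 by simp)
    refine Integrable.mono' (integrable_const 1) (by fun_prop) (Eventually.of_forall fun b => ?_)
    rw [Real.norm_of_nonneg (by positivity)]
    exact Real.exp_le_one_iff.2 (mul_nonpos_of_nonpos_of_nonneg (le_of_lt ht) (hYpos b))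
  have hmom : ∀ k, ∫ b, Y b ^ k * Real.exp (-Y b) ∂P = iteratedDeriv k (mgf Y P) (-1) := by
    intro k
    rw [iteratedDeriv_mgf hYexp]
    simp
  have hXexp := Iio_subset_interior_integrableExpSet hX hpos hint (show (-1 : ℝ) ∈ Iio 0 by simp)
  -- Logarithmic derivative: the transform of Y satisfies L' = x m L near -1, with m the transform
  -- of X dμ. The Leibniz rule then gives the recursion.
  have hderiv : deriv (mgf Y P) =ᶠ[𝓝 (-1)] x • (mgf X (weighted X μ) * mgf Y P) := by
    filter_upwards [isOpen_Iio.mem_nhds (show (-1 : ℝ) ∈ Iio 0 by simp)] with t ht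
    have h1 : mgf Y P =ᶠ[𝓝 t] fun t => Real.exp (x * ∫ a, (Real.exp (t * X a) - 1) ∂μ) := by
      filter_upwards [isOpen_Iio.mem_nhds ht] with s hs using h s (le_of_lt hs)
    rw [h1.deriv_eq, (((hasDerivAt_integral_exp_sub_one hX hpos hint ht).const_mul x).exp).deriv]
    simp only [Pi.smul_apply, Pi.mul_apply, smul_eq_mul, h t (le_of_lt ht)]
    ring
  rw [hmom, iteratedDeriv_succ', hderiv.iteratedDeriv_eq, iteratedDeriv_const_smul_field,
    iteratedDeriv_mul (analyticAt_mgf hXexp).contDiffAt (analyticAt_mgf hYexp).contDiffAt]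
  simp only [iteratedDeriv_mgf_weighted hX hpos hint, hmom, smul_eq_mul]

end Laplace

/-! ### Labels in order of appearance and kernels. -/

section Relabel

variable {m : ℕ}

theorem exists_first (z : Fin m → ℕ) (i : Fin m) :
    ∃ j, z j = z i ∧ ∀ k, z k = z i → j ≤ k := by
  obtain ⟨j, hj, hmin⟩ := (Finset.univ.filter fun j => z j = z i).exists_min_image id ⟨i, by simp⟩
  exact ⟨j, by simpa using hj, fun k hk => hmin k (by simpa using hk)⟩

/-- Of two distinct values, the one first seen later gets the strictly larger label: the values
counted for it include itself, which the other has not yet met. -/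
theorem eq_of_relabel_eq {z : Fin m → ℕ} {i j : Fin m} (h : relabel z i = relabel z j) :
    z i = z j := by
  obtain ⟨p, hp, hp'⟩ := exists_first z i
  obtain ⟨q, hq, hq'⟩ := exists_first z j
  wlog hpq : p ≤ q generalizing i j p q
  · exact (this h.symm q hq hq' p hp hp' (le_of_not_ge hpq)).symm
  by_contra hne
  refine h.not_lt (Finset.card_lt_card ?_)
  rw [Finset.ssubset_iff_of_subset]
  · refine ⟨z j, Finset.mem_image.2 ⟨q, by simpa using hq', hq⟩, fun hmem => ?_⟩
    obtain ⟨k, hk, hkj⟩ := Finset.mem_image.1 hmem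
    have h1 : k ≤ p := (Finset.mem_filter.1 hk).2 p hp
    have h2 : q = p := le_antisymm ((hq' k hkj).trans h1) hpq
    exact hne (by rw [← hp, ← hq, h2])
  · refine Finset.image_subset_image fun k hk => ?_
    simp only [Finset.mem_filter, Finset.mem_univ, true_and] at hk ⊢
    exact fun n hn => ((hk p hp).trans hpq).trans (hq' n hn)

theorem relabel_eq_relabel_iff {z : Fin m → ℕ} {i j : Fin m} :
    relabel z i = relabel z j ↔ z i = z j :=
  ⟨eq_of_relabel_eq, fun h => by simp only [relabel, h]⟩

/-- Equal kernels mean z = g ∘ c with g injective on the range of c, and such a g preserves the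
cardinalities that define the labels. -/
theorem relabel_congr {z c : Fin m → ℕ} (h : ∀ i j, z i = z j ↔ c i = c j) :
    relabel z = relabel c := by
  obtain ⟨g, hg⟩ : ∃ g : ℕ → ℕ, z = g ∘ c :=
    ⟨Function.extend c z 0, (Function.FactorsThrough.extend_comp (f := c) (g := z) 0
      (fun i j hij => (h i j).2 hij)).symm⟩
  funext i
  simp only [relabel, h]
  rw [hg, ← Finset.image_image, Finset.card_image_of_injOn]
  intro a ha b hb hab
  obtain ⟨j, -, rfl⟩ := Finset.mem_image.1 (Finset.mem_coe.1 ha)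
  obtain ⟨k, -, rfl⟩ := Finset.mem_image.1 (Finset.mem_coe.1 hb)
  exact (h j k).1 (by simpa [hg] using hab)

theorem relabel_eq_iff {z c : Fin m → ℕ} (hc : relabel c = c) :
    relabel z = c ↔ ∀ i j, z i = z j ↔ c i = c j := by
  constructor
  · rintro rfl i j
    exact relabel_eq_relabel_iff.symm
  · intro h
    rw [relabel_congr h, hc]

theorem image_eq_Icc {c : Fin m → ℕ} (hc : relabel c = c) :
    Finset.univ.image c = Finset.Icc 1 (numClusters c) := by
  refine Finset.eq_of_subset_of_card_le (fun a ha => ?_) (by simp [numClusters])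
  obtain ⟨i, -, rfl⟩ := Finset.mem_image.1 ha
  rw [← congrFun hc i, Finset.mem_Icc]
  constructor
  · obtain ⟨j, hj, hj'⟩ := exists_first c i
    exact Finset.card_pos.2 ⟨c j, Finset.mem_image.2 ⟨j, by simpa using hj', rfl⟩⟩
  · exact Finset.card_le_card (Finset.image_subset_image (Finset.subset_univ _))

/-- A sequence labelled in order of appearance, as a surjection onto `Fin l`. -/
theorem exists_surjective_fin {c : Fin m → ℕ} (hc : relabel c = c) :
    ∃ d : Fin m → Fin (numClusters c), Function.Surjective d ∧
      ∀ i, c i = d i + 1 := by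
  have hmem : ∀ i, c i ∈ Finset.Icc 1 (numClusters c) := fun i => by
    rw [← image_eq_Icc hc]
    exact Finset.mem_image_of_mem c (Finset.mem_univ i)
  simp only [Finset.mem_Icc] at hmem
  refine ⟨fun i => ⟨c i - 1, by have := hmem i; omega⟩, fun k => ?_, fun i => ?_⟩
  · have : (k : ℕ) + 1 ∈ Finset.univ.image c := by
      rw [image_eq_Icc hc, Finset.mem_Icc]
      exact ⟨by omega, k.2⟩
    obtain ⟨i, -, hi⟩ := Finset.mem_image.1 this
    exact ⟨i, Fin.ext (by simp [hi])⟩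
  · have := (hmem i).1
    simp only
    omega

end Relabel

/-- The functions with the same kernel as a surjection are its compositions with injections. -/
theorem sum_filter_ker_eq {m l : ℕ} {α R : Type*} [Fintype α] [DecidableEq α] [AddCommMonoid R]
    {d : Fin m → Fin l} (hd : Function.Surjective d) (F : (Fin m → α) → R) :
    ∑ b : Fin m → α with ∀ i j, b i = b j ↔ d i = d j, F b =
      ∑ b : Fin l → α with Function.Injective b, F (b ∘ d) := by
  symm
  refine Finset.sum_bij (fun b _ => b ∘ d) ?_ ?_ ?_ ?_
  · intro b hb
    simpa using fun i j => (Finset.mem_filter.1 hb).2.eq_iff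
  · intro b _ b' _ h
    exact hd.injective_comp_right h
  · intro b hb
    have hb' := (Finset.mem_filter.1 hb).2
    refine ⟨b ∘ Function.surjInv hd, ?_, ?_⟩
    · simp only [Finset.mem_filter, Finset.mem_univ, true_and]
      intro i j hij
      simpa [hb', Function.surjInv_eq] using hij
    · funext i
      simp [hb', Function.surjInv_eq]
  · intro b _
    rfl

/-! ### Sums over injective assignments of cells. -/

section InjectiveSums

theorem sum_prod_eq_pow {l : ℕ} {α : Type*} [Fintype α] (x : α → ℝ) :
    ∑ b : Fin l → α, ∏ j, x (b j) = (∑ a, x a) ^ l := by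
  classical
  simpa using (Finset.prod_univ_sum (fun _ : Fin l => Finset.univ) (fun _ a => x a)).symm

/-- Induction on l. Prepending a to b destroys injectivity only if b was not injective or a is one
of the at most l values of b. The latter contribute at most l · max x, and max x ≤ √(∑ x²). -/
theorem tendsto_sum_not_injective {α : ℕ → Type*} [∀ N, Fintype (α N)] [∀ N, DecidableEq (α N)]
    {x : ∀ N, α N → ℝ} {γ : ℝ} (hx : ∀ N a, 0 ≤ x N a) (hsum : ∀ N, ∑ a, x N a = γ)
    (hsq : Tendsto (fun N => ∑ a, x N a ^ 2) atTop (𝓝 0)) (l : ℕ) :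
    Tendsto (fun N => ∑ b : Fin l → α N with ¬ Function.Injective b, ∏ j, x N (b j))
      atTop (𝓝 0) := by
  induction l with
  | zero =>
    refine tendsto_const_nhds.congr fun N => ?_
    rw [Finset.sum_eq_zero]
    intro b hb
    exact absurd (Function.injective_of_subsingleton b) (Finset.mem_filter.1 hb).2
  | succ l ih =>
    have hsqrt : Tendsto (fun N => l * γ ^ l * √(∑ a, x N a ^ 2)) atTop (𝓝 0) := by
      simpa using hsq.sqrt.const_mul (l * γ ^ l)
    refine squeeze_zero (fun N => ?_) (fun N => ?_) (by simpa using (ih.const_mul γ).add hsqrt)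
    · exact Finset.sum_nonneg fun b _ => Finset.prod_nonneg fun j _ => hx N _
    · have hle : ∀ a, x N a ≤ √(∑ a, x N a ^ 2) := fun a => by
        refine Real.le_sqrt_of_sq_le ?_
        exact Finset.single_le_sum (f := fun a => x N a ^ 2) (fun a _ => sq_nonneg _)
          (Finset.mem_univ a)
      have hprod : ∀ b : Fin l → α N, 0 ≤ ∏ j, x N (b j) :=
        fun b => Finset.prod_nonneg fun j _ => hx N _
      calc ∑ b : Fin (l + 1) → α N with ¬ Function.Injective b, ∏ j, x N (b j)
          = ∑ p : α N × (Fin l → α N), if ¬ Function.Injective (Fin.cons p.1 p.2 : _ → α N)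
              then x N p.1 * ∏ j, x N (p.2 j) else 0 := by
            rw [Finset.sum_filter, ← (Fin.consEquiv fun _ => α N).sum_comp]
            refine Finset.sum_congr rfl fun p _ => ?_
            simp [Fin.consEquiv, Fin.prod_univ_succ]
        _ = ∑ b : Fin l → α N, ∑ a, if ¬ Function.Injective (Fin.cons a b : _ → α N)
              then x N a * ∏ j, x N (b j) else 0 := Fintype.sum_prod_type_right _
        _ ≤ ∑ b : Fin l → α N, ((if ¬ Function.Injective b then γ * ∏ j, x N (b j) else 0) +
              (∏ j, x N (b j)) * (l * √(∑ a, x N a ^ 2))) := by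
            refine Finset.sum_le_sum fun b _ => ?_
            calc _ ≤ ∑ a, ((if ¬ Function.Injective b then x N a * ∏ j, x N (b j) else 0) +
                  (∏ j, x N (b j)) * (if a ∈ Finset.univ.image b then x N a else 0)) := by
                  refine Finset.sum_le_sum fun a _ => ?_
                  have h1 := mul_nonneg (hx N a) (hprod b)
                  simp only [Fin.cons_injective_iff]
                  by_cases hb : Function.Injective b <;> by_cases ha : a ∈ Set.range b
                  · have : a ∈ Finset.univ.image b := by simpa using ha
                    simp only [hb, ha, this]
                    simp [mul_comm]
                  · have : a ∉ Finset.univ.image b := by simpa using ha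
                    simp only [hb, ha, this]
                    simp
                  all_goals
                    simp only [hb, and_false, not_false_eq_true, if_true]
                    have : 0 ≤ (∏ j, x N (b j)) *
                        (if a ∈ Finset.univ.image b then x N a else 0) :=
                      mul_nonneg (hprod b) (by split_ifs <;> simp [hx])
                    linarith
              _ = (if ¬ Function.Injective b then γ * ∏ j, x N (b j) else 0) +
                  (∏ j, x N (b j)) * ∑ a ∈ Finset.univ.image b, x N a := by
                  have h3 : ∑ a, (if a ∈ Finset.univ.image b then x N a else 0) =
                      ∑ a ∈ Finset.univ.image b, x N a := by
                    rw [← Finset.sum_filter, Finset.filter_mem_eq_inter, Finset.univ_inter]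
                  rw [Finset.sum_add_distrib, ← Finset.mul_sum, h3]
                  congr 1
                  split_ifs
                  · simp
                  · rw [← Finset.sum_mul, hsum]
              _ ≤ _ := by
                  have h2 : ∑ a ∈ Finset.univ.image b, x N a ≤ l * √(∑ a, x N a ^ 2) := by
                    calc _ ≤ (Finset.univ.image b).card • √(∑ a, x N a ^ 2) :=
                          Finset.sum_le_card_nsmul _ _ _ fun a _ => hle a
                      _ ≤ _ := by
                          rw [nsmul_eq_mul]
                          gcongr
                          exact Finset.card_image_le.trans (by simp)
                  have := hprod b
                  gcongr
        _ = γ * ∑ b : Fin l → α N with ¬ Function.Injective b, ∏ j, x N (b j) +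
              l * γ ^ l * √(∑ a, x N a ^ 2) := by
            rw [Finset.sum_add_distrib, ← Finset.sum_mul, sum_prod_eq_pow, hsum, Finset.mul_sum,
              Finset.sum_filter]
            ring

/-- Over all assignments the sum factors into ∏_j ∑_a f j a, which tends to ∏ γ κ_j because the
errors are quadratic. The non-injective assignments are negligible since |f| is at most a constant
times x. -/
theorem tendsto_sum_injective {α : ℕ → Type*} [∀ N, Fintype (α N)] [∀ N, DecidableEq (α N)]
    {x : ∀ N, α N → ℝ} {γ : ℝ} (hx : ∀ N a, 0 ≤ x N a) (hsum : ∀ N, ∑ a, x N a = γ)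
    (hsq : Tendsto (fun N => ∑ a, x N a ^ 2) atTop (𝓝 0)) {l : ℕ}
    {f : ∀ N, Fin l → α N → ℝ} {κ : Fin l → ℝ} {C : Fin l → ℝ}
    (hf : ∀ N j a, |f N j a - x N a * κ j| ≤ C j * x N a ^ 2) :
    Tendsto (fun N => ∑ b : Fin l → α N with Function.Injective b, ∏ j, f N j (b j))
      atTop (𝓝 (γ ^ l * ∏ j, κ j)) := by
  have hxγ : ∀ N a, x N a ≤ γ := fun N a => by
    rw [← hsum N]
    exact Finset.single_le_sum (fun a _ => hx N a) (Finset.mem_univ a)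
  have hfx : ∀ N j a, |f N j a| ≤ (|κ j| + |C j| * γ) * x N a := fun N j a => by
    have h1 : |f N j a| ≤ |f N j a - x N a * κ j| + |x N a * κ j| := by
      simpa using abs_add_le (f N j a - x N a * κ j) (x N a * κ j)
    rw [abs_mul, abs_of_nonneg (hx N a)] at h1
    have h2 : C j * x N a ^ 2 ≤ |C j| * (γ * x N a) := by
      have := hxγ N a
      have h3 := hx N a
      calc C j * x N a ^ 2 ≤ |C j| * (x N a * x N a) := by
            rw [sq]; gcongr; exact le_abs_self _
        _ ≤ _ := by gcongr
    nlinarith [hf N j a]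
  have hall : Tendsto (fun N => ∑ b : Fin l → α N, ∏ j, f N j (b j)) atTop
      (𝓝 (γ ^ l * ∏ j, κ j)) := by
    have h1 : ∀ N, ∑ b : Fin l → α N, ∏ j, f N j (b j) = ∏ j, ∑ a, f N j a := fun N => by
      rw [Finset.prod_univ_sum]
      simp
    have h2 : γ ^ l * ∏ j, κ j = ∏ j, γ * κ j := by
      rw [Finset.prod_mul_distrib]
      simp
    simp only [h1, h2]
    refine tendsto_finsetProd _ fun j _ => ?_
    rw [tendsto_iff_norm_sub_tendsto_zero]
    refine squeeze_zero (fun N => norm_nonneg _) (fun N => ?_) (by simpa using hsq.const_mul (C j))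
    rw [← hsum N, Finset.sum_mul, ← Finset.sum_sub_distrib, Real.norm_eq_abs, Finset.mul_sum]
    exact (Finset.abs_sum_le_sum_abs _ _).trans (Finset.sum_le_sum fun a _ => hf N j a)
  have hnon : Tendsto (fun N => ∑ b : Fin l → α N with ¬ Function.Injective b,
      ∏ j, f N j (b j)) atTop (𝓝 0) := by
    have h := (tendsto_sum_not_injective hx hsum hsq l).const_mul (∏ j, (|κ j| + |C j| * γ))
    rw [mul_zero] at h
    rw [tendsto_zero_iff_norm_tendsto_zero]
    refine squeeze_zero (fun N => norm_nonneg _) (fun N => ?_) h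
    rw [Real.norm_eq_abs, Finset.mul_sum]
    refine (Finset.abs_sum_le_sum_abs _ _).trans (Finset.sum_le_sum fun b _ => ?_)
    rw [Finset.abs_prod, ← Finset.prod_mul_distrib]
    exact Finset.prod_le_prod (fun j _ => abs_nonneg _) fun j _ => hfx N j _
  have h := hall.sub hnon
  rw [sub_zero] at h
  refine h.congr fun N => ?_
  rw [← Finset.sum_filter_add_sum_filter_not Finset.univ (fun b => Function.Injective b)]
  simp

end InjectiveSums

/-! ### Small-x behaviour of the moment recursion. -/

section Recursion

/-- Polynomials in `x` given by the recursion for normalized tilted moments. -/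
def IsMomentSeq (κ : ℕ → ℝ) (x : ℝ) (q : ℕ → ℝ) : Prop :=
  q 0 = 1 ∧ ∀ n, q (n + 1) = x * ∑ i ∈ Finset.range (n + 1), n.choose i * κ (i + 1) * q (n - i)

theorem exists_bound_momentSeq (κ : ℕ → ℝ) (γ : ℝ) (n : ℕ) :
    ∃ C, 0 ≤ C ∧ ∀ x q, 0 ≤ x → x ≤ γ → IsMomentSeq κ x q → |q n| ≤ C ∧ |q (n + 1)| ≤ C * x := by
  induction n using Nat.strong_induction_on with
  | _ n ih =>
  choose! C hC0 hC using ih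
  -- D k bounds |q k| for every k ≤ n. At k = n > 0 it comes from the bound C (n - 1) · x of the
  -- previous index, with x ≤ γ.
  let D : ℕ → ℝ := fun k => if k < n then C k else if n = 0 then 1 else C (n - 1) * |γ|
  have hD : ∀ k ≤ n, 0 ≤ D k ∧ ∀ x q, 0 ≤ x → x ≤ γ → IsMomentSeq κ x q → |q k| ≤ D k := by
    intro k hk
    rcases hk.lt_or_eq with h | rfl
    · simp only [D, h, if_true]
      exact ⟨hC0 k h, fun x q h0 h1 hq => (hC k h x q h0 h1 hq).1⟩
    · rcases Nat.eq_zero_or_pos k with rfl | hpos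
      · simp only [D]
        exact ⟨by simp, fun x q h0 h1 hq => by simp [hq.1]⟩
      · simp only [D, lt_irrefl, if_false, hpos.ne']
        have hlt : k - 1 < k := by omega
        refine ⟨mul_nonneg (hC0 _ hlt) (abs_nonneg _), fun x q h0 h1 hq => ?_⟩
        have h2 := (hC _ hlt x q h0 h1 hq).2
        rw [Nat.sub_add_cancel hpos] at h2
        have := hC0 _ hlt
        exact h2.trans (by gcongr; exact h1.trans (le_abs_self _))
  refine ⟨D n + ∑ i ∈ Finset.range (n + 1), n.choose i * |κ (i + 1)| * D (n - i), ?_, ?_⟩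
  · exact add_nonneg (hD n le_rfl).1 (Finset.sum_nonneg fun i _ =>
      mul_nonneg (by positivity) (hD _ (Nat.sub_le _ _)).1)
  · intro x q h0 h1 hq
    have hS : |∑ i ∈ Finset.range (n + 1), n.choose i * κ (i + 1) * q (n - i)| ≤
        ∑ i ∈ Finset.range (n + 1), n.choose i * |κ (i + 1)| * D (n - i) := by
      refine (Finset.abs_sum_le_sum_abs _ _).trans (Finset.sum_le_sum fun i _ => ?_)
      rw [abs_mul, abs_mul, Nat.abs_cast]
      have := (hD _ (Nat.sub_le n i)).2 x q h0 h1 hq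
      gcongr
    have hS0 : 0 ≤ ∑ i ∈ Finset.range (n + 1), n.choose i * |κ (i + 1)| * D (n - i) :=
      (abs_nonneg _).trans hS
    constructor
    · linarith [(hD n le_rfl).2 x q h0 h1 hq]
    · rw [hq.2, abs_mul, abs_of_nonneg h0, mul_comm]
      have := (hD n le_rfl).1
      gcongr
      linarith

/-- In the recursion for q n, the last summand contains q 0 = 1 and gives exactly x κ n. Every other
one contains some q k with k ≥ 1, hence a second factor x. -/
theorem exists_bound_momentSeq_sub (κ : ℕ → ℝ) (γ : ℝ) {n : ℕ} (hn : 1 ≤ n) :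
    ∃ C, ∀ x q, 0 ≤ x → x ≤ γ → IsMomentSeq κ x q → |q n - x * κ n| ≤ C * x ^ 2 := by
  obtain ⟨n, rfl⟩ : ∃ k, n = k + 1 := ⟨n - 1, by omega⟩
  choose C hC0 hC using exists_bound_momentSeq κ γ
  refine ⟨∑ i ∈ Finset.range n, n.choose i * |κ (i + 1)| * C (n - i - 1), fun x q h0 h1 hq => ?_⟩
  rw [hq.2, Finset.sum_range_succ, mul_add]
  simp only [Nat.choose_self, Nat.cast_one, one_mul, Nat.sub_self, hq.1, mul_one,
    add_sub_cancel_right]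
  rw [abs_mul, abs_of_nonneg h0, sq, ← mul_assoc, mul_comm x, Finset.sum_mul]
  gcongr
  refine (Finset.abs_sum_le_sum_abs _ _).trans (Finset.sum_le_sum fun i hi => ?_)
  rw [abs_mul, abs_mul, Nat.abs_cast, mul_assoc _ (C _)]
  have h2 := (hC (n - i - 1) x q h0 h1 hq).2
  rw [show n - i - 1 + 1 = n - i by have := Finset.mem_range.1 hi; omega] at h2
  gcongr

end Recursion

/-! ### Integrability and s-finiteness of the Lévy intensity. -/

section LevyIntegrability

variable {ρ : Measure ℝ}

theorem ae_restrict_Ioi_nonneg : ∀ᵐ r ∂(ρ.restrict (Ioi 0)), 0 ≤ id r := by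
  filter_upwards [ae_restrict_mem measurableSet_Ioi] with r hr using le_of_lt hr

theorem integrable_min_one (hρ : ∫⁻ r in Ioi (0 : ℝ), ENNReal.ofReal (min 1 r) ∂ρ < ⊤) :
    Integrable (fun r => min 1 (id r)) (ρ.restrict (Ioi 0)) := by
  refine ⟨by fun_prop, ?_⟩
  rw [hasFiniteIntegral_iff_ofReal]
  · exact hρ
  · filter_upwards [ae_restrict_Ioi_nonneg] with r hr using le_min zero_le_one hr

/-- The density min(1, r) turns ρ into a finite measure and is positive on (0, ∞), so dividing by it
recovers ρ. This makes the product with G₀ amenable to Fubini. -/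
theorem sFinite_restrict_Ioi (hρ : ∫⁻ r in Ioi (0 : ℝ), ENNReal.ofReal (min 1 r) ∂ρ < ⊤) :
    SFinite (ρ.restrict (Ioi 0)) := by
  have hm : Measurable fun r : ℝ => ENNReal.ofReal (min 1 r) := by fun_prop
  have h := withDensity_inv_same₀ (μ := ρ.restrict (Ioi 0)) hm.aemeasurable (by
    filter_upwards [ae_restrict_mem measurableSet_Ioi] with r hr
    simpa using hr) (by simp)
  have : IsFiniteMeasure ((ρ.restrict (Ioi 0)).withDensity fun r => ENNReal.ofReal (min 1 r)) :=
    isFiniteMeasure_withDensity hρ.ne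
  rw [← h]
  infer_instance

end LevyIntegrability

/-! ### Vanishing sum of squared cell masses. -/

section Cells

variable {Ω : Type*} [MeasurableSpace Ω]

/-- The sum is the μ × μ mass of the pairs agreeing in their first N bits. By injectivity of f these
sets decrease to the diagonal, which is null because points are. -/
theorem tendsto_sum_sq_measureReal_cells (μ : Measure Ω) [IsFiniteMeasure μ]
    [NullSingletonClass μ] {f : Ω → ℕ → Bool} (hf : Measurable f) (hinj : Function.Injective f) :
    Tendsto (fun N => ∑ a : Fin N → Bool, μ.real {x | (fun i : Fin N => f x i) = a} ^ 2)
      atTop (𝓝 0) := by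
  have hfi : ∀ i, Measurable fun x => f x i := fun i => measurable_pi_iff.1 hf i
  let D : ℕ → Set (Ω × Ω) := fun N => {p | ∀ i < N, f p.1 i = f p.2 i}
  have hD : ∀ N, MeasurableSet (D N) := fun N => by
    have : D N = ⋂ i, ⋂ (_ : i < N), {p : Ω × Ω | f p.1 i = f p.2 i} := by
      ext p; simp [D]
    rw [this]
    exact MeasurableSet.iInter fun i => MeasurableSet.iInter fun _ =>
      measurableSet_eq_fun ((hfi i).comp measurable_fst) ((hfi i).comp measurable_snd)
  have hcell : ∀ N (a : Fin N → Bool), MeasurableSet {x | (fun i : Fin N => f x i) = a} :=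
    fun N a => (measurable_pi_lambda (fun x (i : Fin N) => f x i) fun i => hfi i)
      (measurableSet_singleton a)
  have hsum : ∀ N, ∑ a : Fin N → Bool, μ.real {x | (fun i : Fin N => f x i) = a} ^ 2 =
      (μ.prod μ).real (D N) := by
    intro N
    have : D N = ⋃ a ∈ (Finset.univ : Finset (Fin N → Bool)),
        {x | (fun i : Fin N => f x i) = a} ×ˢ {x | (fun i : Fin N => f x i) = a} := by
      ext p
      simp only [D, mem_ofPred_eq, Finset.mem_univ, iUnion_true, mem_iUnion, mem_prod]
      constructor
      · intro h
        exact ⟨fun i => f p.1 i, rfl, funext fun i => (h i i.2).symm⟩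
      · rintro ⟨a, h1, h2⟩ i hi
        exact congrFun (h1.trans h2.symm) ⟨i, hi⟩
    rw [this, measureReal_biUnion_finset]
    · simp [measureReal_prod_prod, sq]
    · intro a _ b _ hab
      refine Set.disjoint_left.2 fun p hp hp' => hab ?_
      exact hp.1.symm.trans hp'.1
    · exact fun a _ => (hcell N a).prod (hcell N a)
  have hanti : Antitone D := fun N N' h p hp i hi => hp i (hi.trans_le h)
  have hnull : (μ.prod μ) (⋂ N, D N) = 0 := by
    rw [Measure.measure_prod_null (MeasurableSet.iInter hD)]
    refine Eventually.of_forall fun x => ?_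
    refine measure_mono_null (fun y hy => ?_) (measure_singleton x)
    simp only [mem_preimage, mem_iInter] at hy
    exact (hinj (funext fun i => hy (i + 1) i (by omega))).symm
  have h := tendsto_measure_iInter_atTop (μ := μ.prod μ) (fun N => (hD N).nullMeasurableSet)
    hanti ⟨0, measure_ne_top _ _⟩
  rw [hnull] at h
  simp only [hsum]
  exact (ENNReal.tendsto_toReal ENNReal.zero_ne_top).comp h

end Cells

/-! ### Tilted moments of a completely random measure. -/

section CRM

variable {S Ω : Type*} [MeasurableSpace S] [MeasurableSpace Ω] {P : Measure S}
  {G₀ : Measure Ω} [IsFiniteMeasure G₀] {ρ : Measure ℝ}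
  {G : S → Measure Ω}

theorem IsCompletelyRandomMeasure.measurable_toReal {ν : Measure (ℝ × Ω)}
    (hG : IsCompletelyRandomMeasure P G ν) {A : Set Ω} (hA : MeasurableSet A) :
    Measurable fun s => (G s A).toReal :=
  ((Measure.measurable_coe hA).comp hG.measurable).ennreal_toReal

theorem IsCompletelyRandomMeasure.mgf_eq [IsProbabilityMeasure P]
    (hρ : ∫⁻ r in Ioi (0 : ℝ), ENNReal.ofReal (min 1 r) ∂ρ < ⊤)
    (hG : IsCompletelyRandomMeasure P G (levyMeasure ρ G₀)) {A : Set Ω} (hA : MeasurableSet A)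
    {t : ℝ} (ht : t ≤ 0) :
    mgf (fun s => (G s A).toReal) P t =
      Real.exp (G₀.real A * ∫ r in Ioi (0 : ℝ), (Real.exp (t * id r) - 1) ∂ρ) := by
  have := sFinite_restrict_Ioi hρ
  have hY := hG.measurable_toReal hA
  have hbdd : ∀ t ≤ 0, Integrable (fun s => Real.exp (t * (G s A).toReal)) P := fun t ht => by
    refine Integrable.mono' (integrable_const 1)
        (Measurable.aestronglyMeasurable (by fun_prop)) (Eventually.of_forall fun b => ?_)
    rw [Real.norm_of_nonneg (by positivity)]
    exact Real.exp_le_one_iff.2 (mul_nonpos_of_nonpos_of_nonneg ht ENNReal.toReal_nonneg)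
  have key := one_add_laplaceExponent_eq (P := P) (Y := fun s => (G s A).toReal)
    (μ := ρ.restrict (Ioi 0)) (X := id) (x := G₀.real A) hY (fun _ => ENNReal.toReal_nonneg)
    measurable_id ae_restrict_Ioi_nonneg (integrable_min_one hρ) measureReal_nonneg ?_
    (w := t) (by simpa using ht)
  · rw [laplaceExponent_ofReal, laplaceExponent_ofReal,
      integral_sub (hbdd t ht) (integrable_const 1)] at key
    simp only [integral_const, probReal_univ, one_smul] at key
    have key' : ((∫ s, Real.exp (t * (G s A).toReal) ∂P : ℝ) : ℂ) =
        ((Real.exp (G₀.real A * ∫ r in Ioi (0 : ℝ), (Real.exp (t * id r) - 1) ∂ρ) : ℝ) : ℂ) := by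
      push_cast at key ⊢
      rw [← key]
      ring
    exact_mod_cast key'
  · intro u
    have h1 := hG.charFun A hA u
    -- The integrand depends on r only, so A enters only through the factor G₀(A).
    have h2 : ∫ x in univ ×ˢ A, (Complex.exp (Complex.I * u * (x.1 : ℂ)) - 1) ∂(levyMeasure ρ G₀) =
        G₀.real A * laplaceExponent id (ρ.restrict (Ioi 0)) (u * Complex.I) := by
      rw [levyMeasure, ← Measure.prod_restrict, Measure.restrict_univ,
        integral_fun_fst (fun r : ℝ => Complex.exp (Complex.I * u * (r : ℂ)) - 1)]
      simp [laplaceExponent, mul_comm]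
    rw [h2] at h1
    rw [← h1, laplaceExponent, integral_sub _ (integrable_const 1)]
    · simp [mul_comm]
    · refine Integrable.mono' (integrable_const 1)
        (Measurable.aestronglyMeasurable (by fun_prop)) (Eventually.of_forall fun b => ?_)
      rw [Complex.norm_exp]
      simp

/-- The exponentially tilted moments `E[G(A)^n exp(-G(A))] / E[exp(-G(A))]`. -/
def tiltedMoment (P : Measure S) (G : S → Measure Ω) (A : Set Ω) (n : ℕ) : ℝ :=
  (∫ s, (G s A).toReal ^ n * Real.exp (-(G s A).toReal) ∂P) /
    ∫ s, Real.exp (-(G s A).toReal) ∂P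

theorem IsCompletelyRandomMeasure.integral_exp_neg [IsProbabilityMeasure P]
    (hρ : ∫⁻ r in Ioi (0 : ℝ), ENNReal.ofReal (min 1 r) ∂ρ < ⊤)
    (hG : IsCompletelyRandomMeasure P G (levyMeasure ρ G₀)) {A : Set Ω} (hA : MeasurableSet A) :
    ∫ s, Real.exp (-(G s A).toReal) ∂P =
      Real.exp (G₀.real A * ∫ r in Ioi (0 : ℝ), (Real.exp (-r) - 1) ∂ρ) := by
  simpa [mgf] using hG.mgf_eq hρ hA (t := -1) (by norm_num)

/-- The coefficients depend on ρ alone and A enters only through x = G₀(A), so the recursion bounds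
are uniform over all cells. -/
theorem IsCompletelyRandomMeasure.isMomentSeq [IsProbabilityMeasure P]
    (hρ : ∫⁻ r in Ioi (0 : ℝ), ENNReal.ofReal (min 1 r) ∂ρ < ⊤)
    (hG : IsCompletelyRandomMeasure P G (levyMeasure ρ G₀)) {A : Set Ω} (hA : MeasurableSet A) :
    IsMomentSeq (fun n => ∫ r in Ioi (0 : ℝ), r ^ n * Real.exp (-r) ∂ρ) (G₀.real A)
      (tiltedMoment P G A) := by
  have hne : ∫ s, Real.exp (-(G s A).toReal) ∂P ≠ 0 := by
    rw [hG.integral_exp_neg hρ hA]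
    positivity
  constructor
  · simp [tiltedMoment, div_self hne]
  · intro n
    rw [tiltedMoment, moment_succ_eq (hG.measurable_toReal hA) (fun _ => ENNReal.toReal_nonneg)
      measurable_id ae_restrict_Ioi_nonneg (integrable_min_one hρ)
      (fun t ht => hG.mgf_eq hρ hA ht), mul_div_assoc, Finset.sum_div]
    simp only [tiltedMoment, id, mul_div_assoc]

theorem IsCompletelyRandomMeasure.iIndepFun_of_fintype {ν : Measure (ℝ × Ω)}
    (hG : IsCompletelyRandomMeasure P G ν) {ι : Type*} [Fintype ι] {A : ι → Set Ω}
    (hA : ∀ a, MeasurableSet (A a)) (hdisj : ∀ a b, a ≠ b → Disjoint (A a) (A b)) :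
    iIndepFun (fun a s => G s (A a)) P := by
  let e := Fintype.equivFin ι
  have h := hG.indep (Fintype.card ι) (fun i => A (e.symm i)) (fun i => hA _)
    (fun i j hij => hdisj _ _ (e.symm.injective.ne hij))
  have h2 := h.precomp e.injective
  simpa using h2

theorem integral_exp_neg_mul_prod [IsProbabilityMeasure P]
    (hρ : ∫⁻ r in Ioi (0 : ℝ), ENNReal.ofReal (min 1 r) ∂ρ < ⊤)
    (hG : IsCompletelyRandomMeasure P G (levyMeasure ρ G₀)) {ι : Type*} [Fintype ι]
    [DecidableEq ι] {A : ι → Set Ω} (hA : ∀ a, MeasurableSet (A a))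
    (hdisj : ∀ a b, a ≠ b → Disjoint (A a) (A b)) (hunion : ⋃ a, A a = univ) {l : ℕ}
    {b : Fin l → ι} (hb : Function.Injective b) (n : Fin l → ℕ) :
    ∫ s, Real.exp (-(G s univ).toReal) * ∏ j, (G s (A (b j))).toReal ^ n j ∂P =
      Real.exp (G₀.real univ * ∫ r in Ioi (0 : ℝ), (Real.exp (-r) - 1) ∂ρ) *
        ∏ j, tiltedMoment P G (A (b j)) (n j) := by
  -- The exponent of cell a: n j if a = b j, and 0 off the range of b, where the tilted moment is 1.
  let k : ι → ℕ := fun a => ∑ j, if b j = a then n j else 0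
  have hkb : ∀ j, k (b j) = n j := fun j => by simp [k, hb.eq_iff]
  have hsum : ∀ μ : Measure Ω, μ univ < ⊤ → μ.real univ = ∑ a, μ.real (A a) := by
    intro μ hμ
    have : IsFiniteMeasure μ := ⟨hμ⟩
    rw [← measureReal_biUnion_finset (fun a _ b _ h => hdisj a b h) (fun a _ => hA a)]
    simp [hunion]
  have hind : iIndepFun (fun a s => (G s (A a)).toReal ^ k a * Real.exp (-(G s (A a)).toReal)) P :=
    (hG.iIndepFun_of_fintype hA hdisj).comp
      (fun a x => x.toReal ^ k a * Real.exp (-x.toReal)) (fun a => by fun_prop)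
  have hae : ∀ᵐ s ∂P, Real.exp (-(G s univ).toReal) * ∏ j, (G s (A (b j))).toReal ^ n j =
      ∏ a, ((G s (A a)).toReal ^ k a * Real.exp (-(G s (A a)).toReal)) := by
    filter_upwards [hG.finite] with s hs
    have h1 : (G s univ).toReal = ∑ a, (G s (A a)).toReal := hsum _ hs
    rw [Finset.prod_mul_distrib, h1, ← Finset.sum_neg_distrib, Real.exp_sum, mul_comm]
    congr 1
    simp only [k, ← Finset.prod_pow_eq_pow_sum]
    rw [Finset.prod_comm]
    refine Finset.prod_congr rfl fun j _ => ?_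
    rw [Finset.prod_eq_single (b j)]
    · simp
    · intro a _ ha
      simp [ha.symm]
    · simp
  rw [integral_congr_ae hae, hind.integral_fun_prod_eq_prod_integral]
  · have hq : ∀ a m, ∫ s, (G s (A a)).toReal ^ m * Real.exp (-(G s (A a)).toReal) ∂P =
        Real.exp (G₀.real (A a) * ∫ r in Ioi (0 : ℝ), (Real.exp (-r) - 1) ∂ρ) *
          tiltedMoment P G (A a) m := by
      intro a m
      rw [tiltedMoment, ← hG.integral_exp_neg hρ (hA a), mul_div_cancel₀]
      rw [hG.integral_exp_neg hρ (hA a)]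
      positivity
    simp only [hq]
    rw [Finset.prod_mul_distrib, ← Real.exp_sum, ← Finset.sum_mul,
      ← hsum G₀ (measure_lt_top _ _)]
    congr 1
    rw [← Finset.prod_subset (Finset.subset_univ (Finset.univ.image b)),
      Finset.prod_image hb.injOn]
    · simp [hkb]
    · intro a _ ha
      have : k a = 0 := Finset.sum_eq_zero fun j _ =>
        if_neg fun h => ha (Finset.mem_image.2 ⟨j, Finset.mem_univ j, h⟩)
      rw [this]
      exact (hG.isMomentSeq hρ (hA a)).1
  · intro a
    have := hG.measurable_toReal (hA a)
    fun_prop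

end CRM

/-! ### Discrete measures: label sequences and cells. -/

open ENNReal

theorem tsum_pi_prod {m : ℕ} {β : Type*} (u : Fin m → β → ℝ≥0∞) :
    ∑' k : Fin m → β, ∏ i, u i (k i) = ∏ i, ∑' n, u i n := by
  induction m with
  | zero => simp [tsum_fintype]
  | succ m ih =>
    rw [← (Fin.consEquiv fun _ : Fin (m + 1) => β).tsum_eq, ENNReal.tsum_prod', Fin.prod_univ_succ,
      ← ih, ← ENNReal.tsum_mul_right]
    refine tsum_congr fun a => ?_
    rw [← ENNReal.tsum_mul_left]
    refine tsum_congr fun b => ?_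
    simp [Fin.consEquiv, Fin.prod_univ_succ]

/-- The weight of the `k`-th atom, extended by zero. -/
def weight (K : ℕ∞) (r : ℕ → ℝ) (k : ℕ) : ℝ≥0∞ :=
  if (k : ℕ∞) < K then ENNReal.ofReal (r k) else 0

section Atoms

variable {Ω : Type*} [MeasurableSpace Ω] {K : ℕ∞} {r : ℕ → ℝ} {ω : ℕ → Ω}

theorem atomicMeasure_apply {A : Set Ω} (hA : MeasurableSet A) :
    atomicMeasure K r ω A = ∑' k, weight K r k * A.indicator 1 (ω k) := by
  rw [atomicMeasure, Measure.sum_apply _ hA]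
  have := tsum_subtype {k : ℕ | (k : ℕ∞) < K} fun k => ENNReal.ofReal (r k) * A.indicator 1 (ω k)
  simp only [Measure.smul_apply, Measure.dirac_apply' _ hA, smul_eq_mul]
  refine this.trans (tsum_congr fun k => ?_)
  by_cases hk : (k : ℕ∞) < K <;> simp [weight, hk]

theorem weight_le_atomicMeasure (k : ℕ) : weight K r k ≤ atomicMeasure K r ω univ := by
  rw [atomicMeasure_apply MeasurableSet.univ]
  refine le_trans ?_ (ENNReal.le_tsum k)
  simp

theorem ofReal_likelihood (hpos : ∀ k : ℕ, (k : ℕ∞) < K → 0 < r k)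
    (hfin : atomicMeasure K r ω univ < ⊤) (m : ℕ) (c : Fin m → ℕ) :
    ENNReal.ofReal (likelihood K r ω m c) =
      ENNReal.ofReal (Real.exp (-(atomicMeasure K r ω univ).toReal) / m.factorial) *
        ∏ i, weight K r (c i) := by
  set g := (atomicMeasure K r ω univ).toReal with hg
  have hw : ∀ k : ℕ, (weight K r k).toReal = if (k : ℕ∞) < K then r k else 0 := fun k => by
    by_cases hk : (k : ℕ∞) < K
    · simp [weight, hk, ENNReal.toReal_ofReal (hpos k hk).le]
    · simp [weight, hk]
  -- Cancels the normalisation r_k / g. If g = 0, positivity of the weights excludes any k < K, so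
  -- the division by zero does no harm.
  have hwg : ∀ k : ℕ, g * (if (k : ℕ∞) < K then r k / g else 0) = (weight K r k).toReal := fun k => by
    rw [hw]
    split_ifs with hk
    · rcases eq_or_ne g 0 with h0 | h0
      · have h1 : (weight K r k).toReal ≤ g :=
          ENNReal.toReal_mono hfin.ne (weight_le_atomicMeasure k)
        rw [hw, if_pos hk] at h1
        have := hpos k hk
        linarith
      · field_simp
    · simp
  have h1 : likelihood K r ω m c = Real.exp (-g) / m.factorial * ∏ i, (weight K r (c i)).toReal := by
    rw [likelihood, poissonMeasure_real_singleton]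
    simp only [← hwg, Finset.prod_mul_distrib, ← hg, ENNReal.coe_toNNReal_eq_toReal]
    simp
    ring
  rw [h1, ENNReal.ofReal_mul (by positivity), ENNReal.ofReal_prod_of_nonneg fun _ _ => by positivity]
  congr 1
  refine Finset.prod_congr rfl fun i _ => ENNReal.ofReal_toReal ?_
  exact ((weight_le_atomicMeasure _).trans_lt hfin).ne

theorem prod_atomicMeasure {m : ℕ} {A : Fin m → Set Ω} (hA : ∀ i, MeasurableSet (A i)) :
    ∏ i, atomicMeasure K r ω (A i) =
      ∑' k : Fin m → ℕ, (∏ i, weight K r (k i)) * ∏ i, (A i).indicator 1 (ω (k i)) := by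
  simp only [← Finset.prod_mul_distrib]
  rw [tsum_pi_prod fun i k => weight K r k * (A i).indicator 1 (ω k)]
  exact Finset.prod_congr rfl fun i _ => atomicMeasure_apply (hA i)

theorem tsum_prod_weight (m : ℕ) :
    ∑' k : Fin m → ℕ, ∏ i, weight K r (k i) = atomicMeasure K r ω univ ^ m := by
  have h := prod_atomicMeasure (K := K) (r := r) (ω := ω) (m := m) (A := fun _ => univ)
    fun _ => MeasurableSet.univ
  simpa using h.symm

/-- Summing the weights of the label sequences whose atoms lie in cells with a given kernel. -/
theorem sum_prod_atomicMeasure_cells {α : Type*} [Fintype α] [DecidableEq α] {g : Ω → α}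
    (hg : ∀ a, MeasurableSet {x | g x = a}) {m l : ℕ} {d : Fin m → Fin l}
    (hd : Function.Surjective d) :
    ∑ b : Fin l → α with Function.Injective b, ∏ i, atomicMeasure K r ω {x | g x = b (d i)} =
      ∑' k : Fin m → ℕ, {k : Fin m → ℕ | ∀ i j, g (ω (k i)) = g (ω (k j)) ↔ d i = d j}.indicator
        (fun k => ∏ i, weight K r (k i)) k := by
  refine (sum_filter_ker_eq hd fun b : Fin m → α =>
    ∏ i, atomicMeasure K r ω {x | g x = b i}).symm.trans ?_
  simp only [prod_atomicMeasure fun i => hg _]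
  rw [← Summable.tsum_finsetSum fun _ _ => ENNReal.summable]
  refine tsum_congr fun k => ?_
  rw [← Finset.mul_sum]
  -- A label sequence k contributes only to the colouring of positions by the cells of its own
  -- atoms.
  have h1 : ∀ b : Fin m → α, (∏ i, ({x | g x = b i}.indicator 1 (ω (k i)) : ℝ≥0∞)) =
      if b = fun i => g (ω (k i)) then 1 else 0 := by
    intro b
    split_ifs with h
    · subst h
      simp
    · obtain ⟨i, hi⟩ := Function.ne_iff.1 h
      exact Finset.prod_eq_zero (Finset.mem_univ i) (by simp [Ne.symm hi])
  simp only [h1, Finset.sum_ite_eq', Finset.mem_filter, Finset.mem_univ, true_and]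
  by_cases h : ∀ i j, g (ω (k i)) = g (ω (k j)) ↔ d i = d j
  · rw [if_pos h, indicator_of_mem (by exact h), mul_one]
  · rw [if_neg h, indicator_of_notMem (by exact h), mul_zero]

/-- The finitely many atoms named by a label sequence of nonzero weight lie in different cells once
N is large. Dominated convergence applies, the dominating sum being G(Ω)^m. -/
theorem tendsto_tsum_indicator_cells (hdist : ∀ j k : ℕ, (j : ℕ∞) < K → (k : ℕ∞) < K →
      ω j = ω k → j = k) (hfin : atomicMeasure K r ω univ < ⊤)
    {f : Ω → ℕ → Bool} (hinj : Function.Injective f) {m l : ℕ} (d : Fin m → Fin l) :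
    Tendsto (fun N => ∑' k : Fin m → ℕ,
        {k : Fin m → ℕ | ∀ i j, (fun n : Fin N => f (ω (k i)) n) = (fun n : Fin N => f (ω (k j)) n) ↔
          d i = d j}.indicator (fun k => ∏ i, weight K r (k i)) k) atTop
      (𝓝 (∑' k : Fin m → ℕ, {k : Fin m → ℕ | ∀ i j, k i = k j ↔ d i = d j}.indicator
        (fun k => ∏ i, weight K r (k i)) k)) := by
  simp only [← lintegral_count]
  refine tendsto_lintegral_of_dominated_convergence (fun k => ∏ i, weight K r (k i))
    (fun N => .of_discrete) (fun N => Eventually.of_forall fun k => indicator_le_self _ _ k) ?_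
    (Eventually.of_forall fun k => ?_)
  · rw [lintegral_count, tsum_prod_weight (ω := ω)]
    exact ENNReal.pow_ne_top hfin.ne
  -- Labels k ≥ K may have coinciding ω k, but such sequences have weight zero.
  · by_cases h0 : ∏ i, weight K r (k i) = 0
    · have : ∀ s : Set (Fin m → ℕ), s.indicator (fun k => ∏ i, weight K r (k i)) k = 0 :=
        fun s => indicator_apply_eq_zero.2 fun _ => h0
      simp only [this]
      exact tendsto_const_nhds
    · have hk : ∀ i, (k i : ℕ∞) < K := fun i => by
        by_contra hi
        exact h0 (Finset.prod_eq_zero (Finset.mem_univ i) (by simp [weight, hi]))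
      refine tendsto_const_nhds.congr' ?_
      have hev : ∀ i j, ∀ᶠ N : ℕ in atTop,
          ((fun n : Fin N => f (ω (k i)) n) = (fun n : Fin N => f (ω (k j)) n) ↔ k i = k j) := by
        intro i j
        by_cases hij : k i = k j
        · simp [hij]
        · have hne : f (ω (k i)) ≠ f (ω (k j)) := fun h =>
            hij (hdist _ _ (hk i) (hk j) (hinj h))
          obtain ⟨n, hn⟩ := Function.ne_iff.1 hne
          filter_upwards [eventually_gt_atTop n] with N hN
          simp only [hij, iff_false]
          exact fun h => hn (congrFun h ⟨n, hN⟩)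
      filter_upwards [eventually_all.2 fun i => eventually_all.2 fun j => hev i j] with N hN
      simp only [indicator, mem_ofPred_eq, hN]

end Atoms

/-! ### Law of the sample and its generating function. -/

section Sample

variable {S Ω : Type*} [MeasurableSpace S] [MeasurableSpace Ω] {P : Measure S}
  {G₀ : Measure Ω} {ρ : Measure ℝ}
  {K : S → ℕ∞} {r : ℕ → S → ℝ} {ω : ℕ → S → Ω} {M : S → ℕ} {z : ℕ → S → ℕ}

theorem IsCountMixture.atomsSigma_le (h : IsCountMixture P G₀ ρ K r ω M z) :
    atomsSigma K r ω ≤ ‹MeasurableSpace S› := by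
  refine Measurable.comap_le ?_
  exact h.measurable_K.prodMk ((measurable_pi_lambda _ h.measurable_r).prodMk
    (measurable_pi_lambda _ h.measurable_ω))

theorem IsCountMixture.measurableSet_sample (h : IsCountMixture P G₀ ρ K r ω M z) (m : ℕ)
    (T : Set (Fin m → ℕ)) : MeasurableSet {s | M s = m ∧ (fun i : Fin m => z i s) ∈ T} := by
  have h1 : Measurable fun s => fun i : Fin m => z i s :=
    measurable_pi_lambda _ fun i => h.measurable_z i
  exact (h.measurable_M (measurableSet_singleton m)).inter (h1 (.of_discrete (s := T)))

variable [IsProbabilityMeasure P]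

/-- The likelihood is a version of a conditional probability, from which it inherits measurability
and nonnegativity almost everywhere. -/
theorem IsCountMixture.lintegral_likelihood (h : IsCountMixture P G₀ ρ K r ω M z) (m : ℕ)
    (c : Fin m → ℕ) :
    AEMeasurable (fun s => ENNReal.ofReal
      (likelihood (K s) (fun k => r k s) (fun k => ω k s) m c)) P ∧
    P {s | M s = m ∧ (fun i : Fin m => z i s) = c} = ∫⁻ s, ENNReal.ofReal
      (likelihood (K s) (fun k => r k s) (fun k => ω k s) m c) ∂P := by
  have hE : MeasurableSet {s | M s = m ∧ (fun i : Fin m => z i s) = c} :=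
    h.measurableSet_sample m {c}
  have hs := h.sample m c
  have hint := (integrable_condExp (μ := P) (m := atomsSigma K r ω)
    (f := {s | M s = m ∧ (fun i : Fin m => z i s) = c}.indicator fun _ => (1 : ℝ))).congr hs
  have hnn : 0 ≤ᵐ[P] fun s => likelihood (K s) (fun k => r k s) (fun k => ω k s) m c := by
    have : 0 ≤ᵐ[P] P⟦{s | M s = m ∧ (fun i : Fin m => z i s) = c} | atomsSigma K r ω⟧ :=
      condExp_nonneg (Eventually.of_forall fun s => indicator_nonneg (fun _ _ => zero_le_one) s)
    filter_upwards [this, hs] with s h1 h2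
    rw [← h2]
    exact h1
  refine ⟨hint.aestronglyMeasurable.aemeasurable.ennreal_ofReal, ?_⟩
  rw [← ofReal_integral_eq_lintegral_ofReal hint hnn, ← integral_congr_ae hs,
    integral_condExp h.atomsSigma_le, integral_indicator_const _ hE]
  simp

theorem IsCountMixture.measure_sample (h : IsCountMixture P G₀ ρ K r ω M z) (m : ℕ)
    (T : Set (Fin m → ℕ)) :
    P {s | M s = m ∧ (fun i : Fin m => z i s) ∈ T} =
      ∫⁻ s, ENNReal.ofReal (Real.exp (-(atomicMeasure (K s) (fun k => r k s)
        (fun k => ω k s) univ).toReal) / m.factorial) *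
        ∑' k, T.indicator (fun k => ∏ i, weight (K s) (fun k => r k s) (k i)) k ∂P := by
  have h1 : {s | M s = m ∧ (fun i : Fin m => z i s) ∈ T} =
      ⋃ c ∈ T, {s | M s = m ∧ (fun i : Fin m => z i s) = c} := by
    ext s
    simp
  have h2 : P {s | M s = m ∧ (fun i : Fin m => z i s) ∈ T} = ∑' c : T, ∫⁻ s, ENNReal.ofReal
      (likelihood (K s) (fun k => r k s) (fun k => ω k s) m c) ∂P := by
    rw [h1, measure_biUnion T.to_countable]
    · exact tsum_congr fun c => (h.lintegral_likelihood m c).2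
    · intro c _ c' _ hcc
      exact Set.disjoint_left.2 fun s hs hs' => hcc (hs.2.symm.trans hs'.2)
    · exact fun c _ => h.measurableSet_sample m {c}
  rw [h2, ← lintegral_tsum fun c : T => (h.lintegral_likelihood m c).1]
  refine lintegral_congr_ae ?_
  filter_upwards [h.pos, h.crm.finite] with s hpos hfin
  simp only [ofReal_likelihood hpos hfin]
  rw [ENNReal.tsum_mul_left,
    tsum_subtype T fun c => ∏ i, weight (K s) (fun k => r k s) (c i)]

end Sample

/-- A function given by a power series converging on `[-1, 1]` is analytic at `0`, with
coefficients given by its derivatives. -/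
theorem analyticAt_and_coeff_of_hasSum {F : ℝ → ℝ} {p : ℕ → ℝ}
    (h : ∀ t : ℝ, |t| ≤ 1 → HasSum (fun n => p n * t ^ n) (F t)) :
    AnalyticAt ℝ F 0 ∧ ∀ n, p n = iteratedDeriv n F 0 / n.factorial := by
  have hball : HasFPowerSeriesOnBall F (FormalMultilinearSeries.ofScalars ℝ p) 0 1 := by
    refine ⟨?_, by simp, fun {y} hy => ?_⟩
    -- Convergence at t = 1 is absolute in ℝ, so the radius is at least 1.
    · have hs : Summable fun n => ‖FormalMultilinearSeries.ofScalars ℝ p n‖ *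
          ((1 : NNReal) : ℝ) ^ n := by
        simpa [FormalMultilinearSeries.ofScalars_norm] using (h 1 (by simp)).summable.abs
      exact_mod_cast FormalMultilinearSeries.le_radius_of_summable _ hs
    · have hy' : |y| ≤ 1 := by
        rw [mem_eball_zero_iff] at hy
        rw [← Real.norm_eq_abs, ← toReal_enorm]
        exact ENNReal.toReal_le_of_le_ofReal zero_le_one (by simpa using hy.le)
      simpa [FormalMultilinearSeries.ofScalars_apply_eq, mul_comm] using h y hy'
  refine ⟨hball.analyticAt, fun n => ?_⟩
  have h1 := hball.hasFPowerSeriesAt.eq_formalMultilinearSeries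
    hball.analyticAt.hasFPowerSeriesAt
  exact congrFun (FormalMultilinearSeries.ofScalars_series_injective ℝ ℝ h1) n

section Sample

variable {S Ω : Type*} [MeasurableSpace S] [MeasurableSpace Ω] {P : Measure S}
  [IsProbabilityMeasure P] {M : S → ℕ}

theorem integrable_pow_sample (hM : Measurable M) {t : ℝ} (ht : |t| ≤ 1) :
    Integrable (fun s => t ^ M s) P := by
  have hmeas : Measurable fun s => t ^ M s := (measurable_of_countable (fun n : ℕ => t ^ n)).comp hM
  refine Integrable.mono' (integrable_const 1) hmeas.aestronglyMeasurable
    (Eventually.of_forall fun s => ?_)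
  rw [norm_pow, Real.norm_eq_abs]
  exact pow_le_one₀ (abs_nonneg t) ht

theorem hasSum_sizePGF (hM : Measurable M) {t : ℝ} (ht : |t| ≤ 1) :
    HasSum (fun n => sizePMF P M n * t ^ n) (sizePGF P M t) := by
  have hmap : ∀ n, (P.map M).real {n} = sizePMF P M n := fun n => by
    rw [measureReal_def, Measure.map_apply hM (measurableSet_singleton n)]
    rfl
  have hint : Integrable (fun n : ℕ => t ^ n) (P.map M) :=
    (integrable_map_measure .of_discrete hM.aemeasurable).2 (integrable_pow_sample hM ht)
  have h1 : sizePGF P M t = ∑' n, sizePMF P M n * t ^ n := by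
    rw [sizePGF, ← integral_map (f := fun n : ℕ => t ^ n) hM.aemeasurable .of_discrete,
      integral_countable hint]
    simp [hmap]
  rw [h1]
  refine Summable.hasSum ?_
  have h2 : Summable fun n => (P.map M).real {n} := by
    have : IsFiniteMeasure (P.map M) := Measure.isFiniteMeasure_map P M
    refine ENNReal.summable_toReal ?_
    have h3 := lintegral_countable' (μ := P.map M) fun _ => (1 : ℝ≥0∞)
    simp only [one_mul] at h3
    rw [← h3]
    simp
  refine Summable.of_norm_bounded h2 fun n => ?_
  rw [hmap, norm_mul, norm_pow, Real.norm_eq_abs t, 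
    Real.norm_of_nonneg (show 0 ≤ sizePMF P M n from measureReal_nonneg)]
  exact mul_le_of_le_one_right measureReal_nonneg (pow_le_one₀ (abs_nonneg t) ht)

end Sample

theorem exp_neg_mul_pow_div_le_one (n : ℕ) {x : ℝ} (hx : 0 ≤ x) :
    Real.exp (-x) / n.factorial * x ^ n ≤ 1 := by
  rw [div_mul_eq_mul_div, div_le_one (by positivity), mul_comm]
  exact pow_mul_exp_neg_le n hx

/-! ### The count-mixture model: PGF and cluster probabilities. -/

section Model

variable {S Ω : Type*} [MeasurableSpace S] [MeasurableSpace Ω] {P : Measure S}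
  [IsProbabilityMeasure P] {G₀ : Measure Ω} {ρ : Measure ℝ}
  {K : S → ℕ∞} {r : ℕ → S → ℝ} {ω : ℕ → S → Ω} {M : S → ℕ} {z : ℕ → S → ℕ}

theorem IsCountMixture.sizePMF_eq (h : IsCountMixture P G₀ ρ K r ω M z) (m : ℕ) :
    sizePMF P M m = ∫ s, Real.exp (-(atomicMeasure (K s) (fun k => r k s)
      (fun k => ω k s) univ).toReal) / m.factorial *
        (atomicMeasure (K s) (fun k => r k s) (fun k => ω k s) univ).toReal ^ m ∂P := by
  have hg := h.crm.measurable_toReal MeasurableSet.univ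
  have h1 := h.measure_sample m univ
  simp only [mem_univ, and_true, indicator_univ] at h1
  rw [sizePMF, measureReal_def, h1, integral_eq_lintegral_of_nonneg_ae
    (Eventually.of_forall fun s => by positivity) (Measurable.aestronglyMeasurable (by fun_prop))]
  congr 1
  refine lintegral_congr_ae ?_
  filter_upwards [h.crm.finite] with s hs
  rw [tsum_prod_weight (ω := fun k => ω k s), ENNReal.ofReal_mul (by positivity),
    ENNReal.ofReal_pow (by positivity), ENNReal.ofReal_toReal hs.ne]

theorem IsCountMixture.sizePGF_eq [IsFiniteMeasure G₀]
    (hρ : ∫⁻ r in Ioi (0 : ℝ), ENNReal.ofReal (min 1 r) ∂ρ < ⊤)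
    (h : IsCountMixture P G₀ ρ K r ω M z) {t : ℝ} (ht : |t| ≤ 1) :
    sizePGF P M t =
      Real.exp (G₀.real univ * ∫ r in Ioi (0 : ℝ), (Real.exp (-(1 - t) * r) - 1) ∂ρ) := by
  set g : S → ℝ := fun s => (atomicMeasure (K s) (fun k => r k s) (fun k => ω k s) univ).toReal
    with hg
  have hgm : Measurable g := h.crm.measurable_toReal MeasurableSet.univ
  have hg0 : ∀ s, 0 ≤ g s := fun s => ENNReal.toReal_nonneg
  let F : ℕ → S → ℝ := fun m s => (Real.exp (-g s) / m.factorial * g s ^ m) * t ^ m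
  have hFint : ∀ m, Integrable (F m) P := fun m => by
    refine Integrable.mono' (integrable_const 1) (Measurable.aestronglyMeasurable (by fun_prop))
      (Eventually.of_forall fun s => ?_)
    have h0 := hg0 s
    rw [norm_mul, norm_pow, Real.norm_eq_abs t, Real.norm_of_nonneg (by positivity)]
    exact mul_le_one₀ (exp_neg_mul_pow_div_le_one m h0) (by positivity)
      (pow_le_one₀ (abs_nonneg t) ht)
  have hFI : ∀ m, ∫ s, F m s ∂P = sizePMF P M m * t ^ m := fun m => by
    rw [integral_mul_const, h.sizePMF_eq]
  have hFn : ∀ m, ∫ s, ‖F m s‖ ∂P = |sizePMF P M m * t ^ m| := fun m => by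
    rw [abs_mul, abs_of_nonneg (show 0 ≤ sizePMF P M m from measureReal_nonneg), h.sizePMF_eq,
      ← integral_mul_const]
    congr with s
    have h0 := hg0 s
    rw [norm_mul, Real.norm_eq_abs (t ^ m), Real.norm_of_nonneg (by positivity)]
  have hsum := hasSum_sizePGF (P := P) h.measurable_M ht
  -- Sum and expectation are exchanged: the L¹ norms of the F m are the absolute values of the terms
  -- of the convergent PGF series.
  have h1 := hasSum_integral_of_summable_integral_norm hFint (by
    simp only [hFn]
    exact hsum.summable.abs)
  simp only [hFI] at h1
  rw [hsum.unique h1]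
  have h2 : ∀ s, ∑' m, F m s = Real.exp (-(1 - t) * g s) := fun s => by
    have h3 := (NormedSpace.expSeries_div_hasSum_exp (t * g s)).mul_left (Real.exp (-g s))
    rw [← Real.exp_eq_exp_ℝ, ← Real.exp_add] at h3
    rw [show -(1 - t) * g s = -g s + t * g s by ring, ← h3.tsum_eq]
    refine tsum_congr fun m => ?_
    simp only [F, mul_pow]
    ring
  simp only [h2]
  exact h.crm.mgf_eq hρ MeasurableSet.univ (t := -(1 - t)) (by linarith [(abs_le.1 ht).2])

/-- The partition of the sample is determined, in the limit, by the masses of small cells. -/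
theorem IsCountMixture.tendsto_lintegral_cells (h : IsCountMixture P G₀ ρ K r ω M z)
    {f : Ω → ℕ → Bool} (hf : Measurable f) (hinj : Function.Injective f) {m l : ℕ}
    {d : Fin m → Fin l} (hd : Function.Surjective d) :
    Tendsto (fun N => ∫⁻ s, ENNReal.ofReal (Real.exp (-(atomicMeasure (K s) (fun k => r k s)
        (fun k => ω k s) univ).toReal) / m.factorial) *
      ∑ b : Fin l → (Fin N → Bool) with Function.Injective b,
        ∏ i, atomicMeasure (K s) (fun k => r k s) (fun k => ω k s)
          {x | (fun n : Fin N => f x n) = b (d i)} ∂P) atTop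
      (𝓝 (P {s | M s = m ∧ (fun i : Fin m => z i s) ∈
        {k : Fin m → ℕ | ∀ i j, k i = k j ↔ d i = d j}})) := by
  have hB : ∀ N (a : Fin N → Bool), MeasurableSet {x | (fun n : Fin N => f x n) = a} := fun N a =>
    (measurable_pi_lambda (fun x (i : Fin N) => f x i) fun i => measurable_pi_iff.1 hf i)
      (measurableSet_singleton a)
  have hmu := h.crm.measurable_toReal MeasurableSet.univ
  rw [h.measure_sample]
  refine tendsto_lintegral_of_dominated_convergence' (fun _ => 1) (fun N => ?_) (fun N => ?_)
    (by simp) ?_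
  · have h1 := fun a => (Measure.measurable_coe (hB N a)).comp h.crm.measurable
    have h2 : Measurable fun s => ENNReal.ofReal (Real.exp (-(atomicMeasure (K s) (fun k => r k s)
        (fun k => ω k s) univ).toReal) / m.factorial) := by fun_prop
    exact (h2.mul (Finset.measurable_fun_sum _ fun b _ =>
      Finset.measurable_fun_prod _ fun i _ => h1 _)).aemeasurable
  · filter_upwards [h.crm.finite] with s hs
    rw [sum_prod_atomicMeasure_cells (hB N) hd]
    refine (mul_le_mul_right (ENNReal.tsum_le_tsum fun k => indicator_le_self _ _ k) _).trans ?_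
    rw [tsum_prod_weight (ω := fun k => ω k s), ← ENNReal.ofReal_toReal hs.ne,
      ← ENNReal.ofReal_pow (by positivity), ← ENNReal.ofReal_mul (by positivity),
      ENNReal.toReal_ofReal (by positivity)]
    exact ENNReal.ofReal_le_one.2 (exp_neg_mul_pow_div_le_one m ENNReal.toReal_nonneg)
  · filter_upwards [h.crm.finite, h.distinct] with s hs hdist
    simp only [fun N => sum_prod_atomicMeasure_cells (K := K s) (r := fun k => r k s)
      (ω := fun k => ω k s) (hB N) hd]
    exact ENNReal.Tendsto.const_mul (tendsto_tsum_indicator_cells hdist hs hinj d)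
      (Or.inr ENNReal.ofReal_ne_top)

theorem prod_comp_surjective {m l : ℕ} {d : Fin m → Fin l} (hd : Function.Surjective d)
    (u : Fin l → ℝ) :
    ∏ i, u (d i) = ∏ j, u j ^ (Finset.univ.filter fun i => d i = j).card := by
  rw [Finset.prod_comp, Finset.image_univ_of_surjective hd]

/-- Grouping positions by the fibres of d turns the product of masses into powers over distinct
cells, where independence applies. -/
theorem lintegral_exp_neg_mul_sum_prod [IsFiniteMeasure G₀]
    (hρ : ∫⁻ r in Ioi (0 : ℝ), ENNReal.ofReal (min 1 r) ∂ρ < ⊤) {G : S → Measure Ω}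
    (hG : IsCompletelyRandomMeasure P G (levyMeasure ρ G₀)) {ι : Type*} [Fintype ι]
    [DecidableEq ι] {A : ι → Set Ω} (hA : ∀ a, MeasurableSet (A a))
    (hdisj : ∀ a b, a ≠ b → Disjoint (A a) (A b)) (hunion : ⋃ a, A a = univ) {m l : ℕ}
    {d : Fin m → Fin l} (hd : Function.Surjective d) :
    ∫⁻ s, ENNReal.ofReal (Real.exp (-(G s univ).toReal) / m.factorial) *
        ∑ b : Fin l → ι with Function.Injective b, ∏ i, G s (A (b (d i))) ∂P =
      ENNReal.ofReal
        (Real.exp (G₀.real univ * ∫ r in Ioi (0 : ℝ), (Real.exp (-r) - 1) ∂ρ) / m.factorial *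
          ∑ b : Fin l → ι with Function.Injective b,
            ∏ j, tiltedMoment P G (A (b j)) (Finset.univ.filter fun i => d i = j).card) := by
  set n : Fin l → ℕ := fun j => (Finset.univ.filter fun i => d i = j).card with hn
  have hprod : ∀ u : Fin l → ℝ, ∏ i, u (d i) = ∏ j, u j ^ n j := prod_comp_surjective hd
  have hmu := hG.measurable_toReal MeasurableSet.univ
  have hint : ∀ b : Fin l → ι, Integrable (fun s =>
      Real.exp (-(G s univ).toReal) * ∏ j, (G s (A (b j))).toReal ^ n j) P := fun b => by
    have h1 := fun j => hG.measurable_toReal (hA (b j))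
    refine Integrable.mono' (integrable_const (m.factorial : ℝ))
      (Measurable.aestronglyMeasurable (by fun_prop)) ?_
    filter_upwards [hG.finite] with s hs
    rw [Real.norm_of_nonneg (by positivity), ← hprod fun j => (G s (A (b j))).toReal]
    calc _ ≤ Real.exp (-(G s univ).toReal) * ∏ _i : Fin m, (G s univ).toReal := by
          gcongr with i
          · exact hs.ne
          · exact subset_univ _
      _ = (G s univ).toReal ^ m * Real.exp (-(G s univ).toReal) := by simp [mul_comm]
      _ ≤ _ := pow_mul_exp_neg_le m ENNReal.toReal_nonneg
  have h1 : ∀ᵐ s ∂P, ENNReal.ofReal (Real.exp (-(G s univ).toReal) / m.factorial) *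
        ∑ b : Fin l → ι with Function.Injective b, ∏ i, G s (A (b (d i))) =
      ENNReal.ofReal ((m.factorial : ℝ)⁻¹ * ∑ b : Fin l → ι with Function.Injective b,
        (Real.exp (-(G s univ).toReal) * ∏ j, (G s (A (b j))).toReal ^ n j)) := by
    filter_upwards [hG.finite] with s hs
    rw [← Finset.mul_sum, ← mul_assoc, ← div_eq_inv_mul, ENNReal.ofReal_mul (by positivity),
      ENNReal.ofReal_sum_of_nonneg fun _ _ => by positivity]
    congr 1
    refine Finset.sum_congr rfl fun b _ => ?_
    rw [← hprod fun j => (G s (A (b j))).toReal,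
      ENNReal.ofReal_prod_of_nonneg fun _ _ => ENNReal.toReal_nonneg]
    refine Finset.prod_congr rfl fun i _ => (ENNReal.ofReal_toReal ?_).symm
    exact ((measure_mono (subset_univ _)).trans_lt hs).ne
  rw [lintegral_congr_ae h1, ← ofReal_integral_eq_lintegral_ofReal
    ((integrable_finsetSum _ fun b _ => hint b).const_mul _)
    (Eventually.of_forall fun s => by positivity), integral_const_mul,
    integral_finsetSum _ fun b _ => hint b]
  rw [Finset.sum_congr rfl fun b hb =>
    integral_exp_neg_mul_prod hρ hG hA hdisj hunion (Finset.mem_filter.1 hb).2 n,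
    ← Finset.mul_sum]
  congr 1
  ring

variable [MeasurableSpace.CountablySeparated Ω] [IsFiniteMeasure G₀] [NullSingletonClass G₀]

/-- The joint law of the sample size and of the partition of the sample. -/
theorem IsCountMixture.measure_sample_ker
    (hρ : ∫⁻ r in Ioi (0 : ℝ), ENNReal.ofReal (min 1 r) ∂ρ < ⊤)
    (h : IsCountMixture P G₀ ρ K r ω M z) {m l : ℕ} {d : Fin m → Fin l}
    (hd : Function.Surjective d) :
    P {s | M s = m ∧ (fun i : Fin m => z i s) ∈
        {k : Fin m → ℕ | ∀ i j, k i = k j ↔ d i = d j}} =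
      ENNReal.ofReal (Real.exp (G₀.real univ * ∫ r in Ioi (0 : ℝ), (Real.exp (-r) - 1) ∂ρ) /
        m.factorial * (G₀.real univ ^ l *
          ∏ j, ∫ r in Ioi (0 : ℝ), r ^ (Finset.univ.filter fun i => d i = j).card *
            Real.exp (-r) ∂ρ)) := by
  obtain ⟨f, hf, hinj⟩ :=
    MeasurableSpace.measurable_injection_nat_bool_of_countablySeparated Ω
  have hlim := h.tendsto_lintegral_cells hf hinj hd
  obtain ⟨G, hGdef⟩ : ∃ G : S → Measure Ω, G =
    fun s => atomicMeasure (K s) (fun k => r k s) (fun k => ω k s) := ⟨_, rfl⟩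
  have hG : IsCompletelyRandomMeasure P G (levyMeasure ρ G₀) := hGdef ▸ h.crm
  have hGs : ∀ s, atomicMeasure (K s) (fun k => r k s) (fun k => ω k s) = G s :=
    fun s => by rw [hGdef]
  simp only [hGs] at hlim
  let B : ∀ N, (Fin N → Bool) → Set Ω := fun N a => {x | (fun i : Fin N => f x i) = a}
  have hB : ∀ N a, MeasurableSet (B N a) := fun N a =>
    (measurable_pi_lambda (fun x (i : Fin N) => f x i) fun i => measurable_pi_iff.1 hf i)
      (measurableSet_singleton a)
  have hdisj : ∀ N a b, a ≠ b → Disjoint (B N a) (B N b) := fun N a b hab =>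
    Set.disjoint_left.2 fun x hx hx' => hab (hx.symm.trans hx')
  have hunion : ∀ N, ⋃ a, B N a = univ := fun N =>
    eq_univ_of_forall fun x => mem_iUnion.2 ⟨fun i => f x i, rfl⟩
  have hn : ∀ j, 1 ≤ (Finset.univ.filter fun i => d i = j).card := fun j => by
    obtain ⟨i, hi⟩ := hd j
    exact Finset.card_pos.2 ⟨i, by simpa using hi⟩
  refine tendsto_nhds_unique (hlim.congr fun N =>
    lintegral_exp_neg_mul_sum_prod hρ hG (hB N) (hdisj N) (hunion N) hd) ?_
  refine ENNReal.tendsto_ofReal (Tendsto.const_mul _ ?_)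
  -- The constants depend on the cluster size only, not on the cell or on N. Surjectivity of d makes
  -- every size at least 1, as the expansion requires.
  choose! C hC using fun k (hk : 1 ≤ k) => exists_bound_momentSeq_sub
    (fun n => ∫ r in Ioi (0 : ℝ), r ^ n * Real.exp (-r) ∂ρ) (G₀.real univ) hk
  refine tendsto_sum_injective (x := fun N a => G₀.real (B N a))
    (f := fun N j a => tiltedMoment P G (B N a) (Finset.univ.filter fun i => d i = j).card)
    (C := fun j => C (Finset.univ.filter fun i => d i = j).card)
    (fun N a => measureReal_nonneg) (fun N => ?_)
    (tendsto_sum_sq_measureReal_cells G₀ hf hinj) fun N j a => ?_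
  · rw [← measureReal_biUnion_finset (fun a _ b _ h => hdisj N a b h) (fun a _ => hB N a)]
    simp [hunion]
  · exact hC _ (hn j) _ _ measureReal_nonneg (measureReal_mono (subset_univ _))
      (hG.isMomentSeq hρ (hB N a))

theorem IsCountMixture.ecpf_eq
    (hρ : ∫⁻ r in Ioi (0 : ℝ), ENNReal.ofReal (min 1 r) ∂ρ < ⊤)
    (h : IsCountMixture P G₀ ρ K r ω M z) {m : ℕ} {c : Fin m → ℕ} (hc : relabel c = c) :
    ecpf P M z m c = ecpfFormula (G₀.real univ) ρ m c := by
  obtain ⟨d, hd, hcd⟩ := exists_surjective_fin hc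
  have hker : ∀ i j, c i = c j ↔ d i = d j := fun i j => by
    rw [hcd, hcd, Fin.ext_iff]
    omega
  have hev : clusterEvent M z m c = {s | M s = m ∧ (fun i : Fin m => z i s) ∈
      {k : Fin m → ℕ | ∀ i j, k i = k j ↔ d i = d j}} := by
    ext s
    simp only [clusterEvent, mem_ofPred_eq, relabel_eq_iff hc, hker]
  have hint0 : ∀ n : ℕ, 0 ≤ ∫ r in Ioi (0 : ℝ), r ^ n * Real.exp (-r) ∂ρ := fun n =>
    setIntegral_nonneg measurableSet_Ioi fun r hr => by
      have : 0 < r := hr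
      positivity
  rw [ecpf, measureReal_def, hev, h.measure_sample_ker hρ hd, ENNReal.toReal_ofReal]
  · have hprod : ∏ k ∈ Finset.Icc 1 (numClusters c),
        ∫ r in Ioi (0 : ℝ), r ^ clusterSize c k * Real.exp (-r) ∂ρ =
        ∏ j, ∫ r in Ioi (0 : ℝ), r ^ (Finset.univ.filter fun i => d i = j).card *
          Real.exp (-r) ∂ρ := by
      symm
      refine Finset.prod_bij (fun j _ => (j : ℕ) + 1) (fun j _ => ?_) (fun j _ j' _ hj => ?_)
        (fun k hk => ?_) fun j _ => ?_
      · simp only [Finset.mem_Icc]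
        omega
      · exact Fin.ext (by omega)
      · rw [Finset.mem_Icc] at hk
        exact ⟨⟨k - 1, by omega⟩, Finset.mem_univ _, by simp only; omega⟩
      · simp only [clusterSize, hcd, Nat.add_right_cancel_iff, ← Fin.ext_iff]
    rw [ecpfFormula, hprod]
    ring
  · exact mul_nonneg (by positivity) (mul_nonneg (by positivity)
      (Finset.prod_nonneg fun j _ => hint0 _))

end Model

/-! ### Exchangeability, conditioning and assembly. -/

theorem ecpfFormula_congr {γ₀ : ℝ} {ρ : Measure ℝ} {m : ℕ} {c c' : Fin m → ℕ}
    (h : clusterSizes c = clusterSizes c') :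
    ecpfFormula γ₀ ρ m c = ecpfFormula γ₀ ρ m c' := by
  have hnum : ∀ c : Fin m → ℕ, numClusters c = (clusterSizes c).card := fun c => by
    simp [clusterSizes]
  have hprod : ∀ c : Fin m → ℕ, ∏ k ∈ Finset.Icc 1 (numClusters c),
      ∫ r in Ioi (0 : ℝ), r ^ clusterSize c k * Real.exp (-r) ∂ρ =
      ((clusterSizes c).map fun n => ∫ r in Ioi (0 : ℝ), r ^ n * Real.exp (-r) ∂ρ).prod :=
    fun c => by
      simp only [clusterSizes, Multiset.map_map, Function.comp_def]
      rfl
  rw [ecpfFormula, ecpfFormula, hprod, hprod, hnum, hnum, h]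

/-- This also holds when the size m has probability 0, both sides then being 0. Exchangeability of
`eppf` hence needs no positivity. -/
theorem eppf_eq_div {S : Type*} [MeasurableSpace S] (P : Measure S) [IsProbabilityMeasure P]
    {M : S → ℕ} (hM : Measurable M) (z : ℕ → S → ℕ) (m : ℕ) (c : Fin m → ℕ) :
    eppf P M z m c = ecpf P M z m c / sizePMF P M m := by
  rw [eppf, measureReal_def, cond_apply (s := {s | M s = m}) (hM (measurableSet_singleton m)),
    ENNReal.toReal_mul, ENNReal.toReal_inv, mul_comm, ← div_eq_mul_inv]
  rfl

end CountMixture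

end

theorem mainTheorem3 {S Ω : Type*} [MeasurableSpace S] [MeasurableSpace Ω]
    [MeasurableSpace.CountablySeparated Ω]
    (P : Measure S) [IsProbabilityMeasure P]
    (G₀ : Measure Ω) [IsFiniteMeasure G₀] [NullSingletonClass G₀]
    (ρ : Measure ℝ) (hρ : ∫⁻ r in Ioi (0 : ℝ), ENNReal.ofReal (min 1 r) ∂ρ < ⊤)
    (K : S → ℕ∞) (r : ℕ → S → ℝ) (ω : ℕ → S → Ω) (M : S → ℕ) (z : ℕ → S → ℕ)
    (h : CountMixture.IsCountMixture P G₀ ρ K r ω M z) :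
    -- the integrals in the formulas converge
    (∀ t : ℝ, |t| ≤ 1 → IntegrableOn (fun r => Real.exp (-(1 - t) * r) - 1) (Ioi 0) ρ) ∧
    (∀ n : ℕ, 1 ≤ n → IntegrableOn (fun r => r ^ n * Real.exp (-r)) (Ioi 0) ρ) ∧
    -- the ECPF
    (∀ (m : ℕ) (c : Fin m → ℕ), CountMixture.relabel c = c →
      CountMixture.ecpf P M z m c =
        ∫ s, (P⟦CountMixture.clusterEvent M z m c | CountMixture.atomsSigma K r ω⟧) s ∂P ∧
      CountMixture.ecpf P M z m c = CountMixture.ecpfFormula (G₀.real univ) ρ m c) ∧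
    CountMixture.IsExchangeable (CountMixture.ecpf P M z) ∧
    -- the sample size: PGF and PMF
    (∀ t : ℝ, |t| ≤ 1 → Integrable (fun s => t ^ M s) P ∧
      CountMixture.sizePGF P M t =
        Real.exp (G₀.real univ *
          ∫ r in Ioi (0 : ℝ), (Real.exp (-(1 - t) * r) - 1) ∂ρ)) ∧
    AnalyticAt ℝ (CountMixture.sizePGF P M) 0 ∧
    (∀ m : ℕ, CountMixture.sizePMF P M m =
      iteratedDeriv m (CountMixture.sizePGF P M) 0 / (m.factorial : ℝ)) ∧
    -- the EPPF
    (∀ (m : ℕ) (c : Fin m → ℕ), CountMixture.relabel c = c → 0 < CountMixture.sizePMF P M m →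
      CountMixture.eppf P M z m c =
        CountMixture.ecpf P M z m c / CountMixture.sizePMF P M m ∧
      CountMixture.eppf P M z m c =
        CountMixture.ecpfFormula (G₀.real univ) ρ m c / CountMixture.sizePMF P M m) ∧
    CountMixture.IsExchangeable (CountMixture.eppf P M z) := by
  have hpos := CountMixture.ae_restrict_Ioi_nonneg (ρ := ρ)
  have hint := CountMixture.integrable_min_one hρ
  have hexch : CountMixture.IsExchangeable (CountMixture.ecpf P M z) := by
    intro m c c' hc hc' hcc
    rw [h.ecpf_eq hρ hc, h.ecpf_eq hρ hc', CountMixture.ecpfFormula_congr hcc]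
  have hanalytic := CountMixture.analyticAt_and_coeff_of_hasSum
    fun t ht => CountMixture.hasSum_sizePGF (P := P) h.measurable_M ht
  refine ⟨fun t ht => ?_, fun n hn => ?_, fun m c hc => ⟨?_, h.ecpf_eq hρ hc⟩, hexch,
    fun t ht => ⟨CountMixture.integrable_pow_sample h.measurable_M ht, h.sizePGF_eq hρ ht⟩,
    hanalytic.1, hanalytic.2, fun m c hc _ => ⟨?_, ?_⟩, ?_⟩
  · exact CountMixture.integrable_exp_mul_sub_one measurable_id hpos hint
      (by linarith [(abs_le.1 ht).2])
  · exact CountMixture.integrable_pow_mul_exp_neg measurable_id hpos hint hn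
  · have hE : MeasurableSet (CountMixture.clusterEvent M z m c) :=
      h.measurableSet_sample m {k | CountMixture.relabel k = c}
    -- Tower property.
    rw [integral_condExp h.atomsSigma_le, integral_indicator_const _ hE]
    simp [CountMixture.ecpf]
  · exact CountMixture.eppf_eq_div P h.measurable_M z m c
  · rw [CountMixture.eppf_eq_div P h.measurable_M z m c, h.ecpf_eq hρ hc]
  · intro m c c' hc hc' hcc
    rw [CountMixture.eppf_eq_div P h.measurable_M, CountMixture.eppf_eq_div P h.measurable_M,
      hexch m c c' hc hc' hcc]
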